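/- Let $p>3$ be a prime, $k>1$ an integer and $N=p^{2k}$. Write $e(x)=e^{2\pi i x}$ and let $r\in\mathbb{Z}_N$ be the inverse of $2$. Equip $L^2(\mathbb{Z}_N)$ with the inner product $\langle\phi,\psi\rangle=\frac1N\sum_{Q\in\mathbb{Z}_N}\phi(Q)\overline{\psi(Q)}$, and let $U_N$ be the (Weil) representation of $SL(2,\mathbb{Z}_N)$ on $L^2(\mathbb{Z}_N)$ determined by $$U_N\begin{pmatrix}1&b\\0&1\end{pmatrix}\psi(x)=e\Big(\frac{rbx^2}{N}\Big)\psi(x),\quad U_N\begin{pmatrix}t&0\\0&t^{-1}\end{pmatrix}\psi(x)=\psi(tx),\quad U_N\begin{pmatrix}0&1\\-1&0\end{pmatrix}\psi(x)=\frac{1}{\sqrt N}\sum_{y\in\mathbb{Z}_N}\psi(y)e\Big(\frac{2rxy}{N}\Big).$$ For $D\in\mathbb{Z}_N$ let $H_D=\left\{\begin{pmatrix}a&bD\\b&a\end{pmatrix}: a,b\in\mathbb{Z}_N,\ a^2-Db^2=1\right\}$. A Hecke eigenfunction (for $D$) is a nonzero $\psi\in L^2(\mathbb{Z}_N)$ that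 is an eigenvector of $U_N(h)$ for every $h\in H_D$; it is normalized if $\|\psi\|_2=1$. For $x=(x_1,x_2)\in\mathbb{Z}_N^2$ put $\zeta_x=\sum_{t\in\mathbb{Z}_{p^k}}e\big(\frac{x_1t}{p^k}\big)\delta_{x_2+p^kt}$, and for $C\in\mathbb{Z}_{p^k}$ let $V_C$ be the span of those $\zeta_x$ with $x_1^2-Dx_2^2\equiv -C \pmod{p^k}$. For $n\in\{1,2\}$ and $\alpha\in\mathbb{Z}_{p^n}^\times$ let $$A_{\alpha,n}=p^{-n/2}\sup_{t\in\mathbb{Z}_{p^n}}\Big|\sum_{z=1}^{p^n}e\Big(\frac{\alpha z^3+tz}{p^n}\Big)\Big|.$$ Let $D\in\mathbb{Z}_N$ and let $C\in\mathbb{Z}_{p^k}^\times$ be such that the Legendre symbols satisfy $\left(\frac Cp\right)=\left(\frac Dp\right)$. If $\psi\in V_C$ is a normalized Hecke eigenfunction, then $$\|\psi\|_\infty=\frac{1}{\sqrt{1-\left(\frac Dp\right)\frac1p}}\times\begin{cases}p^{k/3}&\text{if }k\equiv0\pmod 3,\\ A_{36CD,2}\,p^{k/3-1/3}&\text{if }k\equiv1\pmod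 3,\\ A_{36CD,1}\,p^{k/3-1/6}&\text{if }k\equiv2\pmod 3.\end{cases}$$ In particular, for fixed $N$ and a fixed value of $\left(\frac Dp\right)$, the sup norm $\|\psi\|_\infty$ takes at most three values as $D$, $C$ and $\psi$ range over all choices as above. -/

import Mathlib

open scoped BigOperators Matrix

namespace CatMap

noncomputable section

/-- `e(x / n)` for `x ∈ ℤ/nℤ`, where `e(x) = exp (2 π i x)`. -/
def e {n : ℕ} [NeZero n] (x : ZMod n) : ℂ := ZMod.stdAddChar x

/-- The state space `L²(ℤ_N)` with `N = p ^ (2 k)`, as a vector space. -/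
abbrev State (p k : ℕ) : Type := ZMod (p ^ (2 * k)) → ℂ

/-- The norm of `L²(ℤ_N)`, for the inner product `⟨φ, ψ⟩ = N⁻¹ ∑ φ(Q) conj ψ(Q)`. -/
def l2Norm (p k : ℕ) [Fact p.Prime] (ψ : State p k) : ℝ :=
  √((1 / ((p : ℝ) ^ (2 * k))) * ∑ x, ‖ψ x‖ ^ 2)

/-- The supremum norm on `L²(ℤ_N)`. -/
def supNorm (p k : ℕ) (ψ : State p k) : ℝ := ⨆ x, ‖ψ x‖

/-! ### The Weil representation of `SL(2, ℤ_N)` for `N = p ^ (2 k)`, `p` odd -/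

/-- `SL(2, ℤ_N)`. -/
abbrev SL2 (p k : ℕ) : Type := Matrix.SpecialLinearGroup (Fin 2) (ZMod (p ^ (2 * k)))

/-- The matrix `n_b`. -/
def matN (p k : ℕ) (b : ZMod (p ^ (2 * k))) : SL2 p k :=
  ⟨!![1, b; 0, 1], by simp [Matrix.det_fin_two]⟩

/-- The matrix `a_t`. -/
def matA (p k : ℕ) (t : (ZMod (p ^ (2 * k)))ˣ) : SL2 p k :=
  ⟨!![(t : ZMod (p ^ (2 * k))), 0; 0, ((t⁻¹ : (ZMod (p ^ (2 * k)))ˣ) : ZMod (p ^ (2 * k)))],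
    by simp [Matrix.det_fin_two]⟩

/-- The matrix `ω`. -/
def matW (p k : ℕ) : SL2 p k := ⟨!![0, 1; -1, 0], by simp [Matrix.det_fin_two]⟩

/-- The unit `r` of `ℤ_N`, with `2 r = 1`. -/
def r (p k : ℕ) : ZMod (p ^ (2 * k)) := (2 : ZMod (p ^ (2 * k)))⁻¹

/-- `ψ(x) ↦ e(r b x² / N) ψ(x)`, the operator of `n_b`. -/
def opN (p k : ℕ) [Fact p.Prime] (b : ZMod (p ^ (2 * k))) : Module.End ℂ (State p k) where
  toFun ψ x := e (r p k * b * x ^ 2) * ψ x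
  map_add' φ ψ := by ext x; simp [mul_add]
  map_smul' c ψ := by ext x; simp only [Pi.smul_apply, smul_eq_mul, RingHom.id_apply]; ring

/-- `ψ(x) ↦ ψ(t x)`, the operator of `a_t` when `t` is a unit. -/
def opA (p k : ℕ) (t : ZMod (p ^ (2 * k))) : Module.End ℂ (State p k) where
  toFun ψ x := ψ (t * x)
  map_add' φ ψ := by ext x; simp
  map_smul' c ψ := by ext x; simp

/-- `ψ(x) ↦ N^{-1/2} ∑ ψ(y) e(2 r x y / N)`, the operator of `ω`; here `√N = p ^ k`. -/
def opW (p k : ℕ) [Fact p.Prime] : Module.End ℂ (State p k) where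
  toFun ψ x := (1 / (p : ℂ) ^ k) * ∑ y, ψ y * e (2 * r p k * x * y)
  map_add' φ ψ := by ext x; simp [add_mul, mul_add, Finset.sum_add_distrib]
  map_smul' c ψ := by
    ext x
    simp only [Pi.smul_apply, smul_eq_mul, RingHom.id_apply, Finset.mul_sum]
    refine Finset.sum_congr rfl fun y _ => ?_
    ring

open Classical in
/-- The operator `U_N(g)`. A matrix `g = (a b; c d)` with `c` a unit is
`n_{a/c} ω a_{-c} n_{d/c}`; otherwise `a` is a unit and `g = ω (ω⁻¹ g)`, where `ω⁻¹ g` has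
lower left entry `a`. The facts below show that this is, for odd `p`, the one and only
representation of `SL(2, ℤ_N)` with the prescribed values at `n_b`, `a_t` and `ω`. -/
def weil (p k : ℕ) [Fact p.Prime] (g : SL2 p k) : Module.End ℂ (State p k) :=
  if IsUnit (g.1 1 0) then
    opN p k (g.1 0 0 * (g.1 1 0)⁻¹) * opW p k * opA p k (-g.1 1 0) *
      opN p k (g.1 1 1 * (g.1 1 0)⁻¹)
  else
    opW p k * (opN p k (-g.1 1 0 * (g.1 0 0)⁻¹) * opW p k * opA p k (-g.1 0 0) *
      opN p k (g.1 0 1 * (g.1 0 0)⁻¹))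

/-! ### Hecke eigenfunctions and the spaces `V_C` -/

/-- The group `H_D`. -/
def heckeGroup (p k : ℕ) (D : ZMod (p ^ (2 * k))) : Set (SL2 p k) :=
  {g | ∃ a b : ZMod (p ^ (2 * k)), a ^ 2 - D * b ^ 2 = 1 ∧ g.1 = !![a, b * D; b, a]}

/-- Joint eigenfunctions of the Hecke operators `U_N(h)`, `h ∈ H_D`. -/
def IsHeckeEigenfunction (p k : ℕ) [Fact p.Prime] (D : ZMod (p ^ (2 * k)))
    (ψ : State p k) : Prop :=
  ψ ≠ 0 ∧ ∀ h ∈ heckeGroup p k D, ∃ c : ℂ, weil p k h ψ = c • ψ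

/-- `ζ_x = ∑_{t ∈ ℤ_{p^k}} e(x₁ t / p^k) δ_{x₂ + p^k t}`; the vector `(x₁, x₂)` is `(x 0, x 1)`. -/
def zeta (p k : ℕ) [Fact p.Prime] (x : Fin 2 → ZMod (p ^ (2 * k))) : State p k :=
  ∑ t : ZMod (p ^ k), e ((x 0).cast * t) •
    Pi.single (x 1 + (p : ZMod (p ^ (2 * k))) ^ k * (t.val : ZMod (p ^ (2 * k)))) (1 : ℂ)

/-- `V_C`, the span of the `ζ_x` with `x₁² - D x₂² = -C` in `ℤ_{p^k}`. (Up to a root of unity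
`ζ_x` depends only on `x` modulo `p^k`.) -/
def V (p k : ℕ) [Fact p.Prime] (D : ZMod (p ^ (2 * k))) (C : ZMod (p ^ k)) :
    Submodule ℂ (State p k) :=
  Submodule.span ℂ {ψ | ∃ x : Fin 2 → ZMod (p ^ (2 * k)),
    ((x 0).cast : ZMod (p ^ k)) ^ 2 - (D.cast : ZMod (p ^ k)) * ((x 1).cast) ^ 2 = -C ∧
      ψ = zeta p k x}

/-! ### The constants `A_{α,n}` -/

/-- `S(q, n) = ∑_{z mod p^n} e(q(z) / p^n)`. -/
def expSum (p n : ℕ) [Fact p.Prime] (q : Polynomial (ZMod (p ^ n))) : ℂ :=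
  ∑ z : ZMod (p ^ n), e (q.eval z)

/-- `A_{α,n} = p^{-n/2} sup_t |S(α z³ + t z, n)|`. -/
def cubicConst (p n : ℕ) [Fact p.Prime] (α : ZMod (p ^ n)) : ℝ :=
  (⨆ t : ZMod (p ^ n),
    ‖expSum p n (Polynomial.C α * Polynomial.X ^ 3 + Polynomial.C t * Polynomial.X)‖) /
      (p : ℝ) ^ ((n : ℝ) / 2)

/-! ### `weil` is a representation -/

set_option linter.unusedSectionVars false

section facts

variable (p k : ℕ) [Fact p.Prime]

theorem e_add {n : ℕ} [NeZero n] (x y : ZMod n) : e (x + y) = e x * e y :=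
  AddChar.map_add_eq_mul _ _ _

theorem e_zero {n : ℕ} [NeZero n] : e (0 : ZMod n) = 1 := AddChar.map_zero_eq_one _

theorem dvd_N : p ^ k ∣ p ^ (2 * k) := pow_dvd_pow p (by omega)

theorem P_sq : (p : ZMod (p ^ (2 * k))) ^ k * (p : ZMod (p ^ (2 * k))) ^ k = 0 := by
  have h : ((p ^ (2 * k) : ℕ) : ZMod (p ^ (2 * k))) = 0 := ZMod.natCast_self _
  rw [← h]; push_cast; ring

theorem e_P (z : ZMod (p ^ (2 * k))) :
    e ((p : ZMod (p ^ (2 * k))) ^ k * z) = e (z.cast : ZMod (p ^ k)) := by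
  obtain ⟨j, rfl⟩ := ZMod.intCast_surjective z
  have hp : (p : ℂ) ≠ 0 := by exact_mod_cast (Fact.out : p.Prime).ne_zero
  have h1 : (p : ZMod (p ^ (2 * k))) ^ k * (j : ZMod (p ^ (2 * k)))
      = (((p : ℤ) ^ k * j : ℤ) : ZMod (p ^ (2 * k))) := by push_cast; ring
  rw [h1, ZMod.cast_intCast (dvd_N p k)]
  unfold e
  rw [ZMod.stdAddChar_coe, ZMod.stdAddChar_coe]
  congr 1
  push_cast
  rw [pow_mul']
  field_simp

theorem P_mul_eq_iff (z w : ZMod (p ^ (2 * k))) :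
    (p : ZMod (p ^ (2 * k))) ^ k * z = (p : ZMod (p ^ (2 * k))) ^ k * w ↔
      (z.cast : ZMod (p ^ k)) = w.cast := by
  obtain ⟨i, rfl⟩ := ZMod.intCast_surjective z
  obtain ⟨j, rfl⟩ := ZMod.intCast_surjective w
  have hp : ((p : ℤ) ^ k) ≠ 0 := pow_ne_zero _ (by exact_mod_cast (Fact.out : p.Prime).ne_zero)
  have h1 : ∀ j : ℤ, (p : ZMod (p ^ (2 * k))) ^ k * (j : ZMod (p ^ (2 * k)))
      = (((p : ℤ) ^ k * j : ℤ) : ZMod (p ^ (2 * k))) := fun j => by push_cast; ring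
  rw [ZMod.cast_intCast (dvd_N p k), ZMod.cast_intCast (dvd_N p k), h1, h1,
    ZMod.intCast_eq_intCast_iff_dvd_sub, ZMod.intCast_eq_intCast_iff_dvd_sub]
  push_cast
  rw [← mul_sub, two_mul, pow_add]
  exact mul_dvd_mul_iff_left hp

theorem cast_eq_zero_iff (z : ZMod (p ^ (2 * k))) :
    (z.cast : ZMod (p ^ k)) = 0 ↔ ∃ w, z = (p : ZMod (p ^ (2 * k))) ^ k * w := by
  obtain ⟨i, rfl⟩ := ZMod.intCast_surjective z
  rw [ZMod.cast_intCast (dvd_N p k)]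
  constructor
  · intro h
    rw [ZMod.intCast_zmod_eq_zero_iff_dvd] at h
    obtain ⟨j, rfl⟩ := h
    exact ⟨j, by push_cast; ring⟩
  · rintro ⟨w, hw⟩
    have := congrArg (ZMod.castHom (dvd_N p k) (ZMod (p ^ k))) hw
    have h0 : (p : ZMod (p ^ k)) ^ k = 0 := by
      exact_mod_cast ZMod.natCast_self (p ^ k)
    rw [ZMod.castHom_apply, map_mul, map_pow, map_natCast, h0, zero_mul,
      ZMod.cast_intCast (dvd_N p k)] at this
    exact this

theorem val_cast (t : ZMod (p ^ k)) :
    (((t.val : ZMod (p ^ (2 * k)))).cast : ZMod (p ^ k)) = t := by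
  rw [ZMod.cast_natCast (dvd_N p k), ZMod.natCast_zmod_val]

theorem zeta_apply (x : Fin 2 → ZMod (p ^ (2 * k))) (z : ZMod (p ^ (2 * k))) :
    zeta p k x (x 1 + (p : ZMod (p ^ (2 * k))) ^ k * z) =
      e ((p : ZMod (p ^ (2 * k))) ^ k * (x 0 * z)) := by
  unfold zeta
  rw [Finset.sum_apply, Finset.sum_eq_single (z.cast : ZMod (p ^ k))]
  · have h : (p : ZMod (p ^ (2 * k))) ^ k * z =
        (p : ZMod (p ^ (2 * k))) ^ k * (((z.cast : ZMod (p ^ k)).val : ZMod (p ^ (2 * k)))) := by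
      rw [P_mul_eq_iff, val_cast]
    rw [e_P, ZMod.cast_mul (dvd_N p k), Pi.smul_apply, h, Pi.single_eq_same]
    simp
  · intro t _ ht
    rw [Pi.smul_apply, Pi.single_eq_of_ne, smul_zero]
    intro h
    rw [add_right_inj, P_mul_eq_iff, val_cast] at h
    exact ht h.symm
  · simp

theorem zeta_apply_zero (x : Fin 2 → ZMod (p ^ (2 * k))) (y : ZMod (p ^ (2 * k)))
    (h : ¬ ∃ z, y = x 1 + (p : ZMod (p ^ (2 * k))) ^ k * z) : zeta p k x y = 0 := by
  unfold zeta
  rw [Finset.sum_apply]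
  refine Finset.sum_eq_zero fun t _ => ?_
  rw [Pi.smul_apply, Pi.single_eq_of_ne, smul_zero]
  exact fun h' => h ⟨_, h'⟩

theorem two_r (hp : p ≠ 2) : 2 * r p k = 1 := by
  have h2 : Nat.Coprime 2 (p ^ (2 * k)) :=
    Nat.Coprime.pow_right _ ((Nat.coprime_primes Nat.prime_two Fact.out).2 hp.symm)
  have := ZMod.coe_mul_inv_eq_one 2 h2
  simpa [r] using this

theorem opN_zeta (hp : p ≠ 2) (b : ZMod (p ^ (2 * k))) (x : Fin 2 → ZMod (p ^ (2 * k))) :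
    opN p k b (zeta p k x) = e (r p k * (b * x 1 ^ 2)) • zeta p k ![x 0 + b * x 1, x 1] := by
  ext y
  change e (r p k * b * y ^ 2) * zeta p k x y = e (r p k * (b * x 1 ^ 2)) * _
  by_cases h : ∃ z, y = x 1 + (p : ZMod (p ^ (2 * k))) ^ k * z
  · obtain ⟨z, rfl⟩ := h
    have := zeta_apply p k ![x 0 + b * x 1, x 1] z
    simp only [Matrix.cons_val_zero, Matrix.cons_val_one] at this
    rw [zeta_apply, this, ← e_add, ← e_add]
    congr 1
    linear_combination (r p k * b * z ^ 2) * P_sq p k +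
      (p : ZMod (p ^ (2 * k))) ^ k * b * z * x 1 * two_r p k hp
  · rw [zeta_apply_zero p k x y h, zeta_apply_zero p k ![x 0 + b * x 1, x 1] y (by simpa using h)]
    simp

theorem opA_zeta (s s' : ZMod (p ^ (2 * k))) (hs : s * s' = 1)
    (x : Fin 2 → ZMod (p ^ (2 * k))) :
    opA p k s (zeta p k x) = zeta p k ![s * x 0, s' * x 1] := by
  ext y
  change zeta p k x (s * y) = _
  by_cases h : ∃ z, s * y = x 1 + (p : ZMod (p ^ (2 * k))) ^ k * z
  · obtain ⟨z, hz⟩ := h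
    have := zeta_apply p k ![s * x 0, s' * x 1] (s' * z)
    simp only [Matrix.cons_val_zero, Matrix.cons_val_one] at this
    have hy : y = s' * x 1 + (p : ZMod (p ^ (2 * k))) ^ k * (s' * z) := by
      linear_combination s' * hz - y * hs
    rw [hz, hy, zeta_apply, this]
    congr 1
    linear_combination -((p : ZMod (p ^ (2 * k))) ^ k * x 0 * z) * hs
  · rw [zeta_apply_zero p k x _ h, zeta_apply_zero p k ![s * x 0, s' * x 1] y]
    rintro ⟨z, hz⟩
    refine h ⟨s * z, ?_⟩
    simp only [Matrix.cons_val_one] at hz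
    rw [hz]
    simp only [Matrix.cons_val_fin_one]
    linear_combination x 1 * hs

theorem opW_single (a y : ZMod (p ^ (2 * k))) :
    opW p k (Pi.single a 1) y = (1 / (p : ℂ) ^ k) * e (2 * r p k * y * a) := by
  change (1 / (p : ℂ) ^ k) * ∑ z, (Pi.single a 1 : State p k) z * e (2 * r p k * y * z) = _
  rw [Finset.sum_eq_single a]
  · simp
  · intro b _ hb; simp [Pi.single_eq_of_ne hb]
  · simp

theorem sum_e (c : ZMod (p ^ k)) :
    ∑ t : ZMod (p ^ k), e (t * c) = if c = 0 then (p : ℂ) ^ k else 0 := by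
  unfold e
  rw [AddChar.sum_mulShift c (ZMod.isPrimitive_stdAddChar (p ^ k))]
  simp [ZMod.card]

theorem opW_zeta (hp : p ≠ 2) (x : Fin 2 → ZMod (p ^ (2 * k))) :
    opW p k (zeta p k x) = e (-(x 0 * x 1)) • zeta p k ![x 1, -x 0] := by
  have hp0 : (p : ℂ) ^ k ≠ 0 :=
    pow_ne_zero _ (by exact_mod_cast (Fact.out : p.Prime).ne_zero)
  ext y
  have h1 : opW p k (zeta p k x) y =
      (1 / (p : ℂ) ^ k) * (e (y * x 1) * ∑ t : ZMod (p ^ k), e (t * ((x 0 + y).cast))) := by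
    conv_lhs => rw [zeta]
    rw [map_sum, Finset.sum_apply, Finset.mul_sum, Finset.mul_sum]
    refine Finset.sum_congr rfl fun t _ => ?_
    rw [map_smul, Pi.smul_apply, opW_single, two_r p k hp, smul_eq_mul]
    have h2 : e (1 * y * (x 1 + (p : ZMod (p ^ (2 * k))) ^ k * (t.val : ZMod (p ^ (2 * k)))))
        = e (y * x 1) * e (y.cast * t) := by
      rw [show 1 * y * (x 1 + (p : ZMod (p ^ (2 * k))) ^ k * (t.val : ZMod (p ^ (2 * k))))
        = y * x 1 + (p : ZMod (p ^ (2 * k))) ^ k * (y * (t.val : ZMod (p ^ (2 * k)))) by ring,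
        e_add, e_P, ZMod.cast_mul (dvd_N p k), val_cast]
    have h3 : e (t * ((x 0 + y).cast)) = e ((x 0).cast * t) * e (y.cast * t) := by
      rw [← e_add, ZMod.cast_add (dvd_N p k)]; congr 1; ring
    rw [h2, h3]; ring
  rw [h1, sum_e]
  change _ = e (-(x 0 * x 1)) * zeta p k ![x 1, -x 0] y
  by_cases h : ∃ z, x 0 + y = (p : ZMod (p ^ (2 * k))) ^ k * z
  · rw [if_pos ((cast_eq_zero_iff p k _).2 h)]
    obtain ⟨z, hz⟩ := h
    obtain rfl : y = -x 0 + (p : ZMod (p ^ (2 * k))) ^ k * z := by linear_combination hz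
    have := zeta_apply p k ![x 1, -x 0] z
    simp only [Matrix.cons_val_zero, Matrix.cons_val_one] at this
    rw [this, ← e_add]
    field_simp
    congr 1
    ring
  · rw [if_neg (fun h' => h ((cast_eq_zero_iff p k _).1 h')), zeta_apply_zero]
    · simp
    · rintro ⟨z, hz⟩
      refine h ⟨z, ?_⟩
      rw [hz]
      simp

theorem end_ext (S T : Module.End ℂ (State p k)) (h : ∀ x, S (zeta p k x) = T (zeta p k x)) :
    S = T := by
  have hp0 : (p : ℂ) ^ k ≠ 0 :=
    pow_ne_zero _ (by exact_mod_cast (Fact.out : p.Prime).ne_zero)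
  have key : ∀ a : ZMod (p ^ (2 * k)), (Pi.single a 1 : State p k) =
      (1 / (p : ℂ) ^ k) • ∑ c : ZMod (p ^ k), zeta p k ![(c.val : ZMod (p ^ (2 * k))), a] := by
    intro a
    unfold zeta
    rw [Finset.sum_comm]
    have : ∀ t : ZMod (p ^ k), ∑ c : ZMod (p ^ k),
        e (((![(c.val : ZMod (p ^ (2 * k))), a] 0)).cast * t) •
        (Pi.single (![(c.val : ZMod (p ^ (2 * k))), a] 1 +
          (p : ZMod (p ^ (2 * k))) ^ k * (t.val : ZMod (p ^ (2 * k)))) (1 : ℂ) : State p k)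
        = (if t = 0 then (p : ℂ) ^ k else 0) • Pi.single
          (a + (p : ZMod (p ^ (2 * k))) ^ k * (t.val : ZMod (p ^ (2 * k)))) (1 : ℂ) := by
      intro t
      rw [← sum_e, Finset.sum_smul]
      refine Finset.sum_congr rfl fun c _ => ?_
      simp only [Matrix.cons_val_zero, Matrix.cons_val_one, val_cast]
    rw [Finset.sum_congr rfl fun t _ => this t, Finset.sum_eq_single 0]
    · simp [smul_smul, hp0]
    · intro t _ ht; simp [ht]
    · simp
  refine LinearMap.pi_ext' fun a => LinearMap.ext_ring ?_
  simp only [LinearMap.comp_apply, LinearMap.coe_single]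
  rw [key a, map_smul, map_smul, map_sum, map_sum]
  simp only [h]

/-- The unit in the first column of a matrix in `SL(2, ℤ_N)`. -/
theorem isUnit_or (g : SL2 p k) : IsUnit (g.1 1 0) ∨ IsUnit (g.1 0 0) := by
  have hdet : g.1 0 0 * g.1 1 1 - g.1 0 1 * g.1 1 0 = 1 := by
    rw [← Matrix.det_fin_two]; exact g.2
  rcases Nat.eq_zero_or_pos k with rfl | hk
  · left
    have : Subsingleton (ZMod (p ^ (2 * 0))) := by
      rw [mul_zero, pow_zero]; infer_instance
    exact isUnit_of_subsingleton _
  have hd : p ∣ p ^ (2 * k) := dvd_pow_self p (by omega)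
  have hu : ∀ z : ZMod (p ^ (2 * k)), ¬ IsUnit z → (z.cast : ZMod p) = 0 := by
    intro z hz
    obtain ⟨n, rfl⟩ := ZMod.natCast_zmod_surjective z
    rw [ZMod.isUnit_iff_coprime, Nat.coprime_pow_right_iff (by omega), Nat.coprime_comm,
      Nat.Prime.coprime_iff_not_dvd Fact.out, not_not] at hz
    rw [ZMod.cast_natCast hd]
    exact (ZMod.natCast_eq_zero_iff _ _).2 hz
  by_contra! hcon
  have h1 := hu _ hcon.1
  have h2 := hu _ hcon.2
  have := congrArg (ZMod.castHom hd (ZMod p)) hdet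
  rw [map_sub, map_mul, map_mul, map_one] at this
  simp only [ZMod.castHom_apply, h1, h2] at this
  simp at this

theorem cell_zeta (hp : p ≠ 2) (a b c d c' : ZMod (p ^ (2 * k))) (hc : c * c' = 1)
    (hdet : a * d - b * c = 1) (x : Fin 2 → ZMod (p ^ (2 * k))) :
    (opN p k (a * c') * opW p k * opA p k (-c) * opN p k (d * c')) (zeta p k x) =
      e (r p k * ((a * x 0 + b * x 1) * (c * x 0 + d * x 1) - x 0 * x 1)) •
        zeta p k ![a * x 0 + b * x 1, c * x 0 + d * x 1] := by
  have hs : (-c) * (-c') = 1 := by linear_combination hc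
  have h2r := two_r p k hp
  simp only [Module.End.mul_apply]
  rw [opN_zeta p k hp, map_smul, opA_zeta p k (-c) (-c') hs, map_smul, opW_zeta p k hp,
    map_smul, map_smul, opN_zeta p k hp, smul_smul, smul_smul, ← e_add, ← e_add]
  simp only [Matrix.cons_val_zero, Matrix.cons_val_one, Matrix.cons_val_fin_one]
  congr 2
  · grind
  · congr 1
    · grind
    · congr 1
      grind

theorem weil_zeta (hp : p ≠ 2) (g : SL2 p k) (x : Fin 2 → ZMod (p ^ (2 * k))) :
    weil p k g (zeta p k x) =
      e (r p k * ((g.1 *ᵥ x) 0 * (g.1 *ᵥ x) 1 - x 0 * x 1)) • zeta p k (g.1 *ᵥ x) := by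
  have hdet : g.1 0 0 * g.1 1 1 - g.1 0 1 * g.1 1 0 = 1 := by
    rw [← Matrix.det_fin_two]; exact g.2
  have h2r := two_r p k hp
  have hgx : g.1 *ᵥ x =
      ![g.1 0 0 * x 0 + g.1 0 1 * x 1, g.1 1 0 * x 0 + g.1 1 1 * x 1] := by
    ext i; fin_cases i <;> simp [Matrix.mulVec, dotProduct, Fin.sum_univ_two]
  rw [hgx]
  simp only [Matrix.cons_val_zero, Matrix.cons_val_one, Matrix.cons_val_fin_one]
  unfold weil
  split_ifs with h
  · exact cell_zeta p k hp _ _ _ _ _ (ZMod.mul_inv_of_unit _ h) hdet x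
  · have ha := (isUnit_or p k g).resolve_left h
    rw [Module.End.mul_apply, cell_zeta p k hp (-g.1 1 0) (-g.1 1 1) (g.1 0 0) (g.1 0 1) _
      (ZMod.mul_inv_of_unit _ ha) (by linear_combination hdet) x, map_smul, opW_zeta p k hp,
      smul_smul, ← e_add]
    simp only [Matrix.cons_val_zero, Matrix.cons_val_one, Matrix.cons_val_fin_one]
    congr 2
    · grind
    · congr 1
      · congr 1
        ring

/-- `weil` is multiplicative. -/
theorem weil_mul (hp : p ≠ 2) (g h : SL2 p k) : weil p k (g * h) = weil p k g * weil p k h := by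
  refine end_ext p k _ _ fun x => ?_
  rw [Module.End.mul_apply, weil_zeta p k hp, weil_zeta p k hp h, map_smul, weil_zeta p k hp,
    smul_smul, ← e_add, Matrix.mulVec_mulVec, Matrix.SpecialLinearGroup.coe_mul]
  congr 2
  ring

theorem weil_one (hp : p ≠ 2) : weil p k 1 = 1 := by
  refine end_ext p k _ _ fun x => ?_
  rw [weil_zeta p k hp]
  simp [e_zero]

theorem weil_matN (hp : p ≠ 2) (b : ZMod (p ^ (2 * k))) :
    weil p k (matN p k b) = opN p k b := by
  refine end_ext p k _ _ fun x => ?_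
  rw [weil_zeta p k hp, opN_zeta p k hp]
  have h : (matN p k b).1 *ᵥ x = ![x 0 + b * x 1, x 1] := by
    ext i; fin_cases i <;> simp [matN, Matrix.mulVec, dotProduct, Fin.sum_univ_two]
  rw [h]
  simp only [Matrix.cons_val_zero, Matrix.cons_val_one, Matrix.cons_val_fin_one]
  congr 2
  ring

theorem weil_matA (hp : p ≠ 2) (t : (ZMod (p ^ (2 * k)))ˣ) :
    weil p k (matA p k t) = opA p k t := by
  refine end_ext p k _ _ fun x => ?_
  rw [weil_zeta p k hp, opA_zeta p k _ _ t.mul_inv]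
  have h : (matA p k t).1 *ᵥ x =
      ![t * x 0, ((t⁻¹ : (ZMod (p ^ (2 * k)))ˣ) : ZMod (p ^ (2 * k))) * x 1] := by
    ext i; fin_cases i <;> simp [matA, Matrix.mulVec, dotProduct, Fin.sum_univ_two]
  rw [h]
  simp only [Matrix.cons_val_zero, Matrix.cons_val_one, Matrix.cons_val_fin_one]
  have h0 : (t : ZMod (p ^ (2 * k))) * x 0 *
      (((t⁻¹ : (ZMod (p ^ (2 * k)))ˣ) : ZMod (p ^ (2 * k))) * x 1) - x 0 * x 1 = 0 := by
    linear_combination (x 0 * x 1) * t.mul_inv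
  rw [h0, mul_zero, e_zero, one_smul]

theorem weil_matW (hp : p ≠ 2) : weil p k (matW p k) = opW p k := by
  refine end_ext p k _ _ fun x => ?_
  rw [weil_zeta p k hp, opW_zeta p k hp]
  have h : (matW p k).1 *ᵥ x = ![x 1, -x 0] := by
    ext i; fin_cases i <;> simp [matW, Matrix.mulVec, dotProduct, Fin.sum_univ_two]
  rw [h]
  simp only [Matrix.cons_val_zero, Matrix.cons_val_one, Matrix.cons_val_fin_one]
  congr 2
  linear_combination -(x 0 * x 1) * two_r p k hp

/-- There is exactly one representation of `SL(2, ℤ_N)` on `L²(ℤ_N)` with the prescribed values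
at the generators `n_b`, `a_t` and `ω`, namely `weil`. -/
theorem existsUnique_weil (hp : p ≠ 2) :
    ∃! U : SL2 p k →* Module.End ℂ (State p k),
      (∀ b, U (matN p k b) = opN p k b) ∧
      (∀ t : (ZMod (p ^ (2 * k)))ˣ, U (matA p k t) = opA p k t) ∧
      U (matW p k) = opW p k := by
  refine ⟨{ toFun := weil p k, map_one' := weil_one p k hp, map_mul' := weil_mul p k hp },
    ⟨weil_matN p k hp, weil_matA p k hp, weil_matW p k hp⟩, ?_⟩
  rintro U ⟨hN, hA, hW⟩
  have hcell : ∀ g : SL2 p k, IsUnit (g.1 1 0) → U g = weil p k g := by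
    intro g hg
    obtain ⟨t, ht⟩ := hg.neg
    have h1 : g.1 1 0 * (g.1 1 0)⁻¹ = 1 := ZMod.mul_inv_of_unit _ hg
    have hdet : g.1 0 0 * g.1 1 1 - g.1 0 1 * g.1 1 0 = 1 := by
      rw [← Matrix.det_fin_two]; exact g.2
    have hti : ((t⁻¹ : (ZMod (p ^ (2 * k)))ˣ) : ZMod (p ^ (2 * k))) = -(g.1 1 0)⁻¹ := by
      have := t.mul_inv
      rw [ht] at this
      linear_combination -((g.1 1 0)⁻¹) * this -
        ((t⁻¹ : (ZMod (p ^ (2 * k)))ˣ) : ZMod (p ^ (2 * k))) * h1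
    have hg' : g = matN p k (g.1 0 0 * (g.1 1 0)⁻¹) * matW p k * matA p k t *
        matN p k (g.1 1 1 * (g.1 1 0)⁻¹) := by
      apply Subtype.ext
      simp only [Matrix.SpecialLinearGroup.coe_mul]
      simp only [matN, matA, matW, ht, hti]
      rw [Matrix.mul_fin_two, Matrix.mul_fin_two, Matrix.mul_fin_two]
      ext i j
      fin_cases i <;> fin_cases j <;> simp <;> grind
    rw [weil, if_pos hg]
    conv_lhs => rw [hg']
    rw [map_mul, map_mul, map_mul, hN, hN, hW, hA, ht]
  ext1 g
  change U g = weil p k g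
  by_cases hg : IsUnit (g.1 1 0)
  · exact hcell g hg
  · have ha := (isUnit_or p k g).resolve_left hg
    have hw : IsUnit (((matW p k)⁻¹ * g).1 1 0) := by
      have : ((matW p k)⁻¹ * g).1 1 0 = g.1 0 0 := by
        rw [Matrix.SpecialLinearGroup.coe_mul, Matrix.SpecialLinearGroup.coe_inv]
        simp [matW, Matrix.adjugate_fin_two, Matrix.mul_apply, Fin.sum_univ_two]
      rw [this]; exact ha
    have h2 := hcell _ hw
    have h3 : g = matW p k * ((matW p k)⁻¹ * g) := by group
    rw [h3, map_mul, h2, hW, weil_mul p k hp (matW p k), weil_matW p k hp]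

end facts

end

end CatMap

/-!
The key is to describe a Hecke eigenfunction `ψ ∈ V_C` by its coefficients `F(x)` at the functions
`ζ_x`, `x ∈ ℤ_N²` (`zetaCoeff`). The Weil representation moves these coefficients around by the
linear action of `SL(2, ℤ_N)`, up to phases (`zetaCoeff_weil`). Membership in `V_C` confines `F` to
the points that lie on the conic `a² - D b² = -C` modulo `p^k`. The Hecke group acts transitively on
that conic and through phases on `ψ`, so that `|F|` is constant there (`exists_heckeCoeff`); the
constant follows from Parseval's identity and a count of the points (`heckeCoeff_norm`).

The value `ψ(y)` is, up to normalization, the sum of `F(a, y)` over `a`. If `D y² - C` is a unit, at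
most two `a` modulo `p^k` contribute. Otherwise `p ∣ a`, and the sum is split into classes modulo
`q = p^j`, where `j = ⌊2k/3⌋`. Modulo `q⁴ = 0` the exponential `exp(θ √D)`, `θ ∈ q ℤ_N`, is a cubic
polynomial, and it maps `q ℤ_N` into the Hecke group, which acts on `ψ` through an additive
character `θ ↦ e(s θ / N)`. Parametrizing a class by such an orbit turns its sum into a complete
cubic exponential sum (`HeckeCoeff.sum_class`): the phases of `F` are quadratic forms in the
exponential. The condition that the second coordinate be `y` modulo `p^k` is the condition of
stationary phase, so it may be dropped from the sum.

For a class `a + q ℤ_N` with `a = p^l u`, `l < j`, the cubic sum is essentially a quadratic Gauss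
sum (`norm_cubicSum_sq_le`). Its linear coefficient must be divisible by `p^(2j + l)` if the sum is
not zero, which leaves only the classes of `a` and `-a` (`HeckeCoeff.two_classes`), or only the class
of `0`. In the first case the value is at most the root mean square of the cubic sums belonging to
the class of `0` (`sqrt_le_cubicSup`). In the second, the linear coefficient is `p^(3j) v`, all
`v` occur, and the sum is one modulo `p^(2k - 3j)` with leading coefficient `-D C / 6`, which is
`36 C D` up to the cube of `-6`. Here `2k - 3j ∈ {0, 1, 2}`, which gives the three cases.

There are at most three values because `A_{α,n}` depends only on the class of `α` modulo cubes in
the cyclic group of units modulo `p^n`.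
-/

namespace CatMap

noncomputable section

set_option linter.unusedSectionVars false

/-! ### The rings `ℤ/pⁿ` -/

section primePow

theorem pow_eq_zero_of_le_exp {p n m : ℕ} (h : n ≤ m) : (p : ZMod (p ^ n)) ^ m = 0 := by
  have h0 : ((p ^ n : ℕ) : ZMod (p ^ n)) = 0 := ZMod.natCast_self _
  push_cast at h0
  exact pow_eq_zero_of_le h h0

variable {p n : ℕ} [Fact p.Prime]

theorem isUnit_or_dvd (z : ZMod (p ^ n)) : IsUnit z ∨ (p : ZMod (p ^ n)) ∣ z := by
  obtain ⟨m, rfl⟩ := ZMod.natCast_zmod_surjective z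
  by_cases h : p ∣ m
  · exact Or.inr (by exact_mod_cast Nat.cast_dvd_cast h)
  · refine Or.inl ((ZMod.isUnit_iff_coprime _ _).2 (Nat.Coprime.pow_right _ ?_))
    exact (((Fact.out : p.Prime).coprime_iff_not_dvd).2 h).symm

theorem isUnit_add_of_dvd {u z : ZMod (p ^ n)} (hu : IsUnit u) (hz : (p : ZMod (p ^ n)) ∣ z) :
    IsUnit (u + z) := by
  obtain ⟨w, rfl⟩ := hz
  refine IsNilpotent.isUnit_add_left_of_commute ⟨n, ?_⟩ hu (Commute.all _ _)
  rw [mul_pow, pow_eq_zero_of_le_exp le_rfl, zero_mul]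

theorem not_isUnit_of_dvd (hn : n ≠ 0) {z : ZMod (p ^ n)} (hz : (p : ZMod (p ^ n)) ∣ z) :
    ¬ IsUnit z := by
  intro hu
  have : Nontrivial (ZMod (p ^ n)) :=
    ZMod.nontrivial_iff.2 (Nat.one_lt_pow hn (Fact.out : p.Prime).one_lt).ne'
  have h1 := isUnit_of_dvd_unit hz hu
  have h2 := h1.pow n
  rw [pow_eq_zero_of_le_exp le_rfl] at h2
  exact not_isUnit_zero h2

theorem pow_mul_eq_zero_iff_cast {a b : ℕ} (h : a + b = n) (z : ZMod (p ^ n)) :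
    (p : ZMod (p ^ n)) ^ a * z = 0 ↔ (z.cast : ZMod (p ^ b)) = 0 := by
  obtain ⟨i, rfl⟩ := ZMod.intCast_surjective z
  have hp : ((p : ℤ) ^ a) ≠ 0 := pow_ne_zero _ (by exact_mod_cast (Fact.out : p.Prime).ne_zero)
  rw [ZMod.cast_intCast (pow_dvd_pow p (by omega : b ≤ n)), ZMod.intCast_zmod_eq_zero_iff_dvd]
  have h1 : (p : ZMod (p ^ n)) ^ a * (i : ZMod (p ^ n)) =
      (((p : ℤ) ^ a * i : ℤ) : ZMod (p ^ n)) := by push_cast; ring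
  rw [h1, ZMod.intCast_zmod_eq_zero_iff_dvd]
  subst h
  push_cast
  rw [pow_add]
  exact mul_dvd_mul_iff_left hp

theorem cast_eq_zero_iff_natCast_dvd {d m : ℕ} (h : d ∣ m) (z : ZMod m) :
    (z.cast : ZMod d) = 0 ↔ (d : ZMod m) ∣ z := by
  obtain ⟨i, rfl⟩ := ZMod.intCast_surjective z
  rw [ZMod.cast_intCast h]
  constructor
  · intro h0
    rw [ZMod.intCast_zmod_eq_zero_iff_dvd] at h0
    obtain ⟨w, rfl⟩ := h0
    exact ⟨w, by push_cast; ring⟩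
  · rintro ⟨w, hw⟩
    have := congrArg (ZMod.castHom h (ZMod d)) hw
    rw [map_mul, map_natCast, ZMod.natCast_self, zero_mul, map_intCast] at this
    exact this

theorem cast_eq_zero_iff_dvd {b : ℕ} (h : b ≤ n) (z : ZMod (p ^ n)) :
    (z.cast : ZMod (p ^ b)) = 0 ↔ (p : ZMod (p ^ n)) ^ b ∣ z := by
  rw [cast_eq_zero_iff_natCast_dvd (pow_dvd_pow p h), Nat.cast_pow]

theorem pow_mul_eq_zero_iff_dvd {a b : ℕ} (h : a + b = n) (z : ZMod (p ^ n)) :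
    (p : ZMod (p ^ n)) ^ a * z = 0 ↔ (p : ZMod (p ^ n)) ^ b ∣ z := by
  rw [pow_mul_eq_zero_iff_cast h, cast_eq_zero_iff_dvd (by omega)]

theorem pow_dvd_of_pow_dvd_pow_mul {a b : ℕ} (hb : a + b ≤ n) {z : ZMod (p ^ n)}
    (h : (p : ZMod (p ^ n)) ^ (a + b) ∣ (p : ZMod (p ^ n)) ^ a * z) :
    (p : ZMod (p ^ n)) ^ b ∣ z := by
  obtain ⟨w, hw⟩ := h
  have h1 : (p : ZMod (p ^ n)) ^ a * (z - p ^ b * w) = 0 := by rw [mul_sub, hw]; ring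
  rw [pow_mul_eq_zero_iff_dvd (b := n - a) (by omega)] at h1
  have h2 := (pow_dvd_pow (p : ZMod (p ^ n)) (by omega : b ≤ n - a)).trans h1
  exact (dvd_sub_left (Dvd.intro _ rfl)).1 h2

theorem not_pow_dvd_pow_mul_of_isUnit {a b : ℕ} (hab : a < b) (hb : b ≤ n) {u : ZMod (p ^ n)}
    (hu : IsUnit u) : ¬ (p : ZMod (p ^ n)) ^ b ∣ (p : ZMod (p ^ n)) ^ a * u := by
  intro h
  obtain ⟨c, rfl⟩ := Nat.exists_eq_add_of_lt hab
  rw [add_assoc] at h hb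
  have h1 := pow_dvd_of_pow_dvd_pow_mul hb h
  exact not_isUnit_of_dvd (by omega) ((dvd_pow_self _ (by omega)).trans h1) hu

theorem pow_dvd_or_exists_isUnit (j : ℕ) (z : ZMod (p ^ n)) :
    (p : ZMod (p ^ n)) ^ j ∣ z ∨ ∃ l < j, ∃ u, IsUnit u ∧ z = (p : ZMod (p ^ n)) ^ l * u := by
  induction j with
  | zero => simp
  | succ j ih =>
    rcases ih with ⟨w, rfl⟩ | ⟨l, hl, u, hu, rfl⟩
    · rcases isUnit_or_dvd w with hw | ⟨w', rfl⟩
      · exact Or.inr ⟨j, by omega, w, hw, rfl⟩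
      · exact Or.inl ⟨w', by ring⟩
    · exact Or.inr ⟨l, by omega, u, hu, rfl⟩

theorem isUnit_natCast_of_not_dvd {m : ℕ} (h : ¬ p ∣ m) : IsUnit (m : ZMod (p ^ n)) :=
  (ZMod.isUnit_iff_coprime _ _).2
    (Nat.Coprime.pow_right _ (((Fact.out : p.Prime).coprime_iff_not_dvd).2 h).symm)

theorem isUnit_two (hp : p ≠ 2) : IsUnit (2 : ZMod (p ^ n)) := by
  have := isUnit_natCast_of_not_dvd (p := p) (n := n) (m := 2)
    fun h => hp ((Nat.prime_dvd_prime_iff_eq Fact.out Nat.prime_two).1 h)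
  exact_mod_cast this

/-- A map `t ↦ u t + p (⋯) (t² or t³)` with `u` a unit permutes `ℤ/pⁿ`: its difference quotients
are units. -/
theorem bijective_of_sub_eq_unit_mul {f : ZMod (p ^ n) → ZMod (p ^ n)}
    (hf : ∀ s t, ∃ u, IsUnit u ∧ f s - f t = u * (s - t)) : Function.Bijective f := by
  rw [← Finite.injective_iff_bijective]
  intro s t hst
  obtain ⟨u, hu, h⟩ := hf s t
  rw [hst, sub_self] at h
  exact sub_eq_zero.1 ((hu.mul_right_eq_zero).1 h.symm)

theorem exists_sq_eq_one_add_mul (hp : p ≠ 2) (μ : ZMod (p ^ n)) :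
    ∃ ν : ZMod (p ^ n), (1 + p * ν) ^ 2 = 1 + p * μ := by
  have h2 : IsUnit (2 : ZMod (p ^ n)) := isUnit_two hp
  have hb : Function.Bijective fun ν : ZMod (p ^ n) => 2 * ν + p * ν ^ 2 :=
    bijective_of_sub_eq_unit_mul fun s t =>
      ⟨2 + p * (s + t), isUnit_add_of_dvd h2 (Dvd.intro _ rfl), by ring⟩
  obtain ⟨ν, hν⟩ := hb.2 μ
  exact ⟨ν, by linear_combination (p : ZMod (p ^ n)) * hν⟩

end primePow

/-! ### Summation over residue rings -/

section sums

theorem card_cast_fiber {m M : ℕ} [NeZero m] [NeZero M] (h : m ∣ M) (w : ZMod m) :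
    m * (Finset.univ.filter fun z : ZMod M => (z.cast : ZMod m) = w).card = M := by
  have hc : ∀ w' : ZMod m, (Finset.univ.filter fun z : ZMod M => (z.cast : ZMod m) = w').card =
      (Finset.univ.filter fun z : ZMod M => (z.cast : ZMod m) = w).card := by
    intro w'
    have hs := ZMod.castHom_surjective h
    exact AddMonoidHom.card_fiber_eq_of_mem_range (ZMod.castHom h (ZMod m)) (hs w') (hs w)
  have := Finset.card_eq_sum_card_fiberwise (s := (Finset.univ : Finset (ZMod M)))
    (t := (Finset.univ : Finset (ZMod m))) (f := fun z => (z.cast : ZMod m)) (by simp)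
  rw [Finset.sum_congr rfl fun w' _ => hc w'] at this
  simpa [ZMod.card] using this.symm

theorem sum_comp_cast {m M c : ℕ} [NeZero m] [NeZero M] (h : m * c = M) (f : ZMod m → ℂ) :
    ∑ z : ZMod M, f z.cast = c * ∑ w, f w := by
  have hd : m ∣ M := ⟨c, h.symm⟩
  rw [← Finset.sum_fiberwise (s := Finset.univ) (g := fun z : ZMod M => (z.cast : ZMod m)),
    Finset.mul_sum]
  refine Finset.sum_congr rfl fun w _ => ?_
  rw [Finset.sum_congr rfl (g := fun _ => f w)
    (fun z hz => by rw [(Finset.mem_filter.1 hz).2]), Finset.sum_const, nsmul_eq_mul]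
  have := card_cast_fiber hd w
  have h2 := Nat.eq_of_mul_eq_mul_left (NeZero.pos m) (this.trans h.symm)
  rw [h2]

theorem card_pow_mul_eq_zero {p n a b : ℕ} [Fact p.Prime] (h : a + b = n) :
    (Finset.univ.filter fun z : ZMod (p ^ n) => (p : ZMod (p ^ n)) ^ a * z = 0).card = p ^ a := by
  have h1 := card_cast_fiber (m := p ^ b) (M := p ^ n) (pow_dvd_pow p (by omega)) 0
  simp_rw [pow_mul_eq_zero_iff_cast h]
  refine Nat.eq_of_mul_eq_mul_left (Nat.pow_pos (n := b) (Fact.out : p.Prime).pos) (h1.trans ?_)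
  rw [← pow_add, add_comm b, h]

/-- Summing over all classes `b + q R` covers every element equally often. -/
theorem sum_sum_add_mul {m : ℕ} [NeZero m] (q : ZMod m) (f : ZMod m → ℂ) :
    ∑ b, ∑ t, f (b + q * t) = m * ∑ b, f b := by
  have h : ∀ t, ∑ b, f (b + q * t) = ∑ b, f b :=
    fun t => Equiv.sum_comp (Equiv.addRight (q * t)) f
  rw [Finset.sum_comm, Finset.sum_congr rfl fun t _ => h t]
  simp [ZMod.card]

theorem norm_e {m : ℕ} [NeZero m] (x : ZMod m) : ‖e x‖ = 1 := AddChar.norm_apply _ _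

theorem e_neg {m : ℕ} [NeZero m] (x : ZMod m) : e (-x) = (starRingEnd ℂ) (e x) :=
  AddChar.map_neg_eq_conj _ _

theorem e_neg_mul {m : ℕ} [NeZero m] (x : ZMod m) : e (-x) * e x = 1 := by
  rw [← e_add, neg_add_cancel, e_zero]

theorem sum_e_mul {m : ℕ} [NeZero m] (c : ZMod m) :
    ∑ t : ZMod m, e (c * t) = if c = 0 then (m : ℂ) else 0 := by
  unfold e
  simp_rw [mul_comm c]
  rw [AddChar.sum_mulShift c (ZMod.isPrimitive_stdAddChar m)]
  simp [ZMod.card]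

theorem eq_zero_of_forall_e_mul {m : ℕ} [NeZero m] {c : ZMod m} (h : ∀ t, e (c * t) = 1) :
    c = 0 := by
  by_contra hc
  have := sum_e_mul c
  rw [if_neg hc, Finset.sum_congr rfl fun t _ => h t] at this
  exact NeZero.ne m (by simpa [ZMod.card] using this)

/-- A character that is trivial on the annihilator of `p ^ a` comes from a multiple of `p ^ a`. -/
theorem pow_dvd_of_forall_e_mul {p n a : ℕ} [Fact p.Prime] (ha : a ≤ n) {c : ZMod (p ^ n)}
    (h : ∀ s, (p : ZMod (p ^ n)) ^ a * s = 0 → e (c * s) = 1) : (p : ZMod (p ^ n)) ^ a ∣ c := by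
  rw [← pow_mul_eq_zero_iff_dvd (a := n - a) (by omega)]
  refine eq_zero_of_forall_e_mul fun t => ?_
  rw [mul_comm _ c, mul_assoc]
  refine h _ ?_
  rw [← mul_assoc, ← pow_add, pow_eq_zero_of_le_exp (by omega), zero_mul]

theorem exists_eq_e_mul {m : ℕ} [NeZero m] (χ : AddChar (ZMod m) ℂ) :
    ∃ s : ZMod m, ∀ t, χ t = e (s * t) := by
  have hinj : Function.Injective fun s : ZMod m => AddChar.mulShift (ZMod.stdAddChar (N := m)) s :=
    AddChar.to_mulShift_inj_of_isPrimitive (ZMod.isPrimitive_stdAddChar m)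
  have hbij := (Fintype.bijective_iff_injective_and_card _).2 ⟨hinj, (AddChar.card_eq).symm⟩
  obtain ⟨s, hs⟩ := hbij.2 χ
  exact ⟨s, fun t => by rw [← hs]; rfl⟩

end sums

/-- A Plancherel identity: if the frequencies `G t` are each taken `c` times and `F` depends only
on the frequency, the mean square of `∑ F(t) e(a G(t))` over `a` is `c ∑ |F(t)|²`. -/
theorem sum_norm_sq_sum_mul_e {m : ℕ} [NeZero m] (F : ZMod m → ℂ) (G : ZMod m → ZMod m) (c : ℕ)
    (hF : ∀ s t, G s = G t → F s = F t)
    (hc : ∀ t, (Finset.univ.filter fun s => G s = G t).card = c) :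
    ∑ a, ‖∑ t, F t * e (a * G t)‖ ^ 2 = m * c * ∑ t, ‖F t‖ ^ 2 := by
  have h1 : ∀ a, ((‖∑ t, F t * e (a * G t)‖ ^ 2 : ℝ) : ℂ) =
      ∑ t, ∑ s, F t * (starRingEnd ℂ) (F s) * e ((G t - G s) * a) := by
    intro a
    push_cast
    rw [← Complex.mul_conj', map_sum, Finset.sum_mul_sum]
    refine Finset.sum_congr rfl fun t _ => Finset.sum_congr rfl fun s _ => ?_
    rw [map_mul, ← e_neg, show (G t - G s) * a = a * G t + -(a * G s) by ring, e_add]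
    ring
  have h2 : ∀ t, ∑ s, F t * (starRingEnd ℂ) (F s) * (if G t - G s = 0 then (m : ℂ) else 0) =
      m * c * ((‖F t‖ ^ 2 : ℝ) : ℂ) := by
    intro t
    have h3 : ∀ s, F t * (starRingEnd ℂ) (F s) * (if G t - G s = 0 then (m : ℂ) else 0) =
        if G s = G t then m * ((‖F t‖ ^ 2 : ℝ) : ℂ) else 0 := by
      intro s
      by_cases h : G s = G t
      · rw [if_pos h, if_pos (by rw [h, sub_self]), hF s t h, Complex.mul_conj']
        push_cast; ring
      · rw [if_neg h, if_neg (fun h' => h (sub_eq_zero.1 h').symm), mul_zero]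
    rw [Finset.sum_congr rfl fun s _ => h3 s, ← Finset.sum_filter, Finset.sum_const, hc,
      nsmul_eq_mul]
    ring
  have h4 : ((∑ a, ‖∑ t, F t * e (a * G t)‖ ^ 2 : ℝ) : ℂ) =
      ((m * c * ∑ t, ‖F t‖ ^ 2 : ℝ) : ℂ) := by
    rw [Complex.ofReal_sum, Finset.sum_congr rfl fun a _ => h1 a, Finset.sum_comm]
    simp_rw [Finset.sum_comm (s := (Finset.univ : Finset (ZMod m)))
      (f := fun a s => F _ * (starRingEnd ℂ) (F s) * e ((G _ - G s) * a)), ← Finset.mul_sum,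
      sum_e_mul, h2]
    push_cast
    rw [Finset.mul_sum]
  exact_mod_cast h4

/-! ### Coefficients against the functions `ζ_x` -/

section coeff

variable (p k : ℕ) [Fact p.Prime]

/-- The coefficient `∑_t ψ(b + p^k t) e(-a t / p^k)` of `ψ` at `ζ_(a, b)`. The sum is over
`t ∈ ℤ_N` instead of `ℤ_{p^k}`, so that it is `p^k` times the pairing of `ψ` with `ζ_(a, b)`. -/
def zetaCoeff (a b : ZMod (p ^ (2 * k))) : State p k →ₗ[ℂ] ℂ where
  toFun ψ := ∑ t, ψ (b + (p : ZMod (p ^ (2 * k))) ^ k * t) *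
    e (-((p : ZMod (p ^ (2 * k))) ^ k * a * t))
  map_add' φ ψ := by simp [add_mul, Finset.sum_add_distrib]
  map_smul' c ψ := by simp [Finset.mul_sum, mul_assoc]

theorem zetaCoeff_apply (a b : ZMod (p ^ (2 * k))) (ψ : State p k) :
    zetaCoeff p k a b ψ = ∑ t, ψ (b + (p : ZMod (p ^ (2 * k))) ^ k * t) *
      e (-((p : ZMod (p ^ (2 * k))) ^ k * a * t)) := rfl

theorem zetaCoeff_add (a b u v : ZMod (p ^ (2 * k))) (ψ : State p k) :
    zetaCoeff p k (a + (p : ZMod (p ^ (2 * k))) ^ k * u) (b + (p : ZMod (p ^ (2 * k))) ^ k * v) ψ =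
      e ((p : ZMod (p ^ (2 * k))) ^ k * a * v) * zetaCoeff p k a b ψ := by
  rw [zetaCoeff_apply, zetaCoeff_apply, ← Equiv.sum_comp (Equiv.addRight (-v)), Finset.mul_sum]
  refine Finset.sum_congr rfl fun t _ => ?_
  rw [Equiv.coe_addRight, mul_left_comm, ← e_add]
  congr 2
  · ring
  · linear_combination (u * v - u * t) * P_sq p k

theorem zetaCoeff_zeta_self (z : Fin 2 → ZMod (p ^ (2 * k))) :
    zetaCoeff p k (z 0) (z 1) (zeta p k z) = (p : ℂ) ^ (2 * k) := by
  rw [zetaCoeff_apply]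
  have h : ∀ t, zeta p k z (z 1 + (p : ZMod (p ^ (2 * k))) ^ k * t) *
      e (-((p : ZMod (p ^ (2 * k))) ^ k * z 0 * t)) = 1 := by
    intro t
    rw [zeta_apply, ← e_add, ← e_zero (n := p ^ (2 * k))]
    congr 1; ring
  rw [Finset.sum_congr rfl fun t _ => h t]
  simp [ZMod.card]

theorem zetaCoeff_zeta_add (z : Fin 2 → ZMod (p ^ (2 * k))) (u v : ZMod (p ^ (2 * k))) :
    zetaCoeff p k (z 0 + (p : ZMod (p ^ (2 * k))) ^ k * u)
      (z 1 + (p : ZMod (p ^ (2 * k))) ^ k * v) (zeta p k z) =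
      e ((p : ZMod (p ^ (2 * k))) ^ k * z 0 * v) * (p : ℂ) ^ (2 * k) := by
  rw [zetaCoeff_add, zetaCoeff_zeta_self]

/-- The functions `ζ_z` are orthogonal for different `z` modulo `p^k`. -/
theorem zetaCoeff_zeta_eq_zero (z : Fin 2 → ZMod (p ^ (2 * k))) (a b : ZMod (p ^ (2 * k)))
    (h : ¬ ∃ u v, a = z 0 + (p : ZMod (p ^ (2 * k))) ^ k * u ∧
      b = z 1 + (p : ZMod (p ^ (2 * k))) ^ k * v) :
    zetaCoeff p k a b (zeta p k z) = 0 := by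
  by_cases hb : ∃ v, b = z 1 + (p : ZMod (p ^ (2 * k))) ^ k * v
  · obtain ⟨v, rfl⟩ := hb
    rw [show a = a + (p : ZMod (p ^ (2 * k))) ^ k * 0 by ring, zetaCoeff_add, zetaCoeff_apply]
    have h1 : ∀ t, zeta p k z (z 1 + (p : ZMod (p ^ (2 * k))) ^ k * t) *
        e (-((p : ZMod (p ^ (2 * k))) ^ k * a * t)) =
        e ((p : ZMod (p ^ (2 * k))) ^ k * (z 0 - a) * t) := by
      intro t
      rw [zeta_apply, ← e_add]
      congr 1; ring
    rw [Finset.sum_congr rfl fun t _ => h1 t, sum_e_mul, if_neg, mul_zero]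
    rw [pow_mul_eq_zero_iff_dvd (b := k) (by omega)]
    rintro ⟨u, hu⟩
    exact h ⟨-u, v, by linear_combination -hu, rfl⟩
  · rw [zetaCoeff_apply]
    refine Finset.sum_eq_zero fun t _ => ?_
    rw [zeta_apply_zero, zero_mul]
    rintro ⟨v, hv⟩
    exact hb ⟨v - t, by linear_combination hv⟩

theorem functional_ext (S T : State p k →ₗ[ℂ] ℂ) (h : ∀ x, S (zeta p k x) = T (zeta p k x)) :
    S = T := by
  have := end_ext p k (LinearMap.pi fun _ => S) (LinearMap.pi fun _ => T)
    (fun x => by ext; simp [h])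
  ext1 i
  ext1
  simpa using congrFun (LinearMap.congr_fun this (LinearMap.single ℂ (fun _ => ℂ) i 1)) 0

/-- The Weil representation permutes the coefficients, up to phases. -/
theorem zetaCoeff_weil (hp : p ≠ 2) (g : SL2 p k) (a b : ZMod (p ^ (2 * k))) (ψ : State p k) :
    zetaCoeff p k (g.1 0 0 * a + g.1 0 1 * b) (g.1 1 0 * a + g.1 1 1 * b) (weil p k g ψ) =
      e (r p k * ((g.1 0 0 * a + g.1 0 1 * b) * (g.1 1 0 * a + g.1 1 1 * b) - a * b)) *
        zetaCoeff p k a b ψ := by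
  have hdet : g.1 0 0 * g.1 1 1 - g.1 0 1 * g.1 1 0 = 1 := by
    rw [← Matrix.det_fin_two]; exact g.2
  suffices h : (zetaCoeff p k (g.1 0 0 * a + g.1 0 1 * b) (g.1 1 0 * a + g.1 1 1 * b)).comp
      (weil p k g) =
      e (r p k * ((g.1 0 0 * a + g.1 0 1 * b) * (g.1 1 0 * a + g.1 1 1 * b) - a * b)) •
        zetaCoeff p k a b from LinearMap.congr_fun h ψ
  refine functional_ext p k _ _ fun z => ?_
  rw [LinearMap.comp_apply, weil_zeta p k hp, map_smul, LinearMap.smul_apply, smul_eq_mul,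
    smul_eq_mul]
  have hgz : g.1 *ᵥ z =
      ![g.1 0 0 * z 0 + g.1 0 1 * z 1, g.1 1 0 * z 0 + g.1 1 1 * z 1] := by
    ext i; fin_cases i <;> simp [Matrix.mulVec, dotProduct, Fin.sum_univ_two]
  by_cases h : ∃ u v, a = z 0 + (p : ZMod (p ^ (2 * k))) ^ k * u ∧
      b = z 1 + (p : ZMod (p ^ (2 * k))) ^ k * v
  · obtain ⟨u, v, rfl, rfl⟩ := h
    have h1 := zetaCoeff_zeta_add p k (g.1 *ᵥ z) (g.1 0 0 * u + g.1 0 1 * v)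
      (g.1 1 0 * u + g.1 1 1 * v)
    rw [hgz] at h1 ⊢
    simp only [Matrix.cons_val_zero, Matrix.cons_val_one, Matrix.cons_val_fin_one] at h1 ⊢
    rw [show g.1 0 0 * (z 0 + (p : ZMod (p ^ (2 * k))) ^ k * u) +
        g.1 0 1 * (z 1 + (p : ZMod (p ^ (2 * k))) ^ k * v) = g.1 0 0 * z 0 + g.1 0 1 * z 1 +
        (p : ZMod (p ^ (2 * k))) ^ k * (g.1 0 0 * u + g.1 0 1 * v) by ring,
      show g.1 1 0 * (z 0 + (p : ZMod (p ^ (2 * k))) ^ k * u) +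
        g.1 1 1 * (z 1 + (p : ZMod (p ^ (2 * k))) ^ k * v) = g.1 1 0 * z 0 + g.1 1 1 * z 1 +
        (p : ZMod (p ^ (2 * k))) ^ k * (g.1 1 0 * u + g.1 1 1 * v) by ring, h1,
      zetaCoeff_zeta_add, ← mul_assoc, ← mul_assoc, ← e_add, ← e_add]
    congr 2
    generalize g.1 0 0 = A at *
    generalize g.1 0 1 = B at *
    generalize g.1 1 0 = Γ at *
    generalize g.1 1 1 = Δ at *
    have h2 := two_r p k hp
    have h3 := P_sq p k
    set P := (p : ZMod (p ^ (2 * k))) ^ k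
    linear_combination (P * (z 0 * v - z 1 * u) * r p k) * hdet
      + (- r p k * ((A * u + B * v) * (Γ * u + Δ * v) - u * v)) * h3
      + (P * (z 0 * v - (A * z 0 + B * z 1) * (Γ * u + Δ * v))) * h2
  · rw [zetaCoeff_zeta_eq_zero p k z a b h, zetaCoeff_zeta_eq_zero, mul_zero, mul_zero]
    rintro ⟨u, v, hu, hv⟩
    rw [hgz] at hu hv
    simp only [Matrix.cons_val_zero, Matrix.cons_val_one, Matrix.cons_val_fin_one] at hu hv
    refine h ⟨g.1 1 1 * u - g.1 0 1 * v, g.1 0 0 * v - g.1 1 0 * u, ?_, ?_⟩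
    · linear_combination g.1 1 1 * hu - g.1 0 1 * hv + (z 0 - a) * hdet
    · linear_combination g.1 0 0 * hv - g.1 1 0 * hu + (z 1 - b) * hdet

theorem sum_zetaCoeff (y : ZMod (p ^ (2 * k))) (ψ : State p k) :
    ∑ a, zetaCoeff p k a y ψ = (p : ℂ) ^ (3 * k) * ψ y := by
  simp_rw [zetaCoeff_apply]
  rw [Finset.sum_comm]
  have h : ∀ t, ∑ a, ψ (y + (p : ZMod (p ^ (2 * k))) ^ k * t) *
      e (-((p : ZMod (p ^ (2 * k))) ^ k * a * t)) =
      if (p : ZMod (p ^ (2 * k))) ^ k * t = 0 then (p : ℂ) ^ (2 * k) * ψ y else 0 := by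
    intro t
    rw [← Finset.mul_sum]
    have h1 : ∀ a, e (-((p : ZMod (p ^ (2 * k))) ^ k * a * t)) =
      e (-((p : ZMod (p ^ (2 * k))) ^ k * t) * a) := fun a => by congr 1; ring
    rw [Finset.sum_congr rfl fun a _ => h1 a, sum_e_mul]
    by_cases h0 : (p : ZMod (p ^ (2 * k))) ^ k * t = 0
    · rw [h0, if_pos neg_zero, if_pos rfl, add_zero]; push_cast; ring
    · rw [if_neg h0, if_neg (fun h' => h0 (neg_eq_zero.1 h')), mul_zero]
  rw [Finset.sum_congr rfl fun t _ => h t, ← Finset.sum_filter, Finset.sum_const,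
    card_pow_mul_eq_zero (b := k) (by omega), nsmul_eq_mul]
  push_cast
  ring

theorem sum_norm_sq_zetaCoeff (ψ : State p k) :
    ∑ a, ∑ b, ‖zetaCoeff p k a b ψ‖ ^ 2 = (p : ℝ) ^ (5 * k) * ∑ y, ‖ψ y‖ ^ 2 := by
  have h : ∀ b, ∑ a, ‖zetaCoeff p k a b ψ‖ ^ 2 =
      (p : ℝ) ^ (3 * k) * ∑ t, ‖ψ (b + (p : ZMod (p ^ (2 * k))) ^ k * t)‖ ^ 2 := by
    intro b
    have := sum_norm_sq_sum_mul_e (fun t => ψ (b + (p : ZMod (p ^ (2 * k))) ^ k * t))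
      (fun t => -((p : ZMod (p ^ (2 * k))) ^ k * t)) (p ^ k)
      (fun s t h => by rw [neg_inj] at h; simp only [h]) (fun t => by
        rw [← card_pow_mul_eq_zero (p := p) (n := 2 * k) (a := k) (b := k) (by omega)]
        refine Finset.card_equiv (Equiv.addRight (-t)) fun s => ?_
        simp only [Finset.mem_filter, Finset.mem_univ, true_and, Equiv.coe_addRight, neg_inj,
          mul_add, mul_neg]
        rw [← sub_eq_add_neg, sub_eq_zero])
    simp_rw [zetaCoeff_apply]
    have h1 : ∀ a t : ZMod (p ^ (2 * k)), -((p : ZMod (p ^ (2 * k))) ^ k * a * t) =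
      a * -((p : ZMod (p ^ (2 * k))) ^ k * t) := fun a t => by ring
    simp_rw [h1]
    rw [this]
    push_cast
    ring
  rw [Finset.sum_comm, Finset.sum_congr rfl fun b _ => h b, ← Finset.mul_sum]
  rw [Finset.sum_comm]
  have h1 : ∀ t, ∑ b, ‖ψ (b + (p : ZMod (p ^ (2 * k))) ^ k * t)‖ ^ 2 = ∑ y, ‖ψ y‖ ^ 2 := fun t =>
    Equiv.sum_comp (Equiv.addRight ((p : ZMod (p ^ (2 * k))) ^ k * t)) fun y => ‖ψ y‖ ^ 2
  rw [Finset.sum_congr rfl fun t _ => h1 t]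
  simp [ZMod.card]
  ring

end coeff

/-! ### Points on the conic `a² - D b² = -C` -/

section conic

theorem card_conic_zmod_prime (p : ℕ) [Fact p.Prime] (hp : p ≠ 2) (d : ℤ) (c y₀ : ZMod p)
    (hd : (d : ZMod p) ≠ 0) (hy : y₀ ≠ 0) (hc : c = d * y₀ ^ 2) :
    ((Finset.univ.filter fun x : ZMod p × ZMod p => x.1 ^ 2 - d * x.2 ^ 2 + c = 0).card : ℤ) =
      p - legendreSym p d := by
  have h2 : (2 : ZMod p) ≠ 0 := by
    have : Fact (2 < p) := ⟨lt_of_le_of_ne (Fact.out : p.Prime).two_le hp.symm⟩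
    exact ZMod.neg_one_ne_one.symm ∘ fun h => by linear_combination h
  have hs := legendreSym.card_sqrts p hp d
  have hsplit := Finset.card_filter_add_card_filter_not (s := (Finset.univ : Finset (ZMod p)))
    (fun s => s ^ 2 = (d : ZMod p))
  have hbij : (Finset.univ.filter fun s : ZMod p => ¬ s ^ 2 = (d : ZMod p)).card =
      ((Finset.univ.filter fun x : ZMod p × ZMod p =>
        x.1 ^ 2 - d * x.2 ^ 2 + c = 0).erase (0, y₀)).card := by
    -- the line of slope `s` through `(0, y₀)` meets the conic in one further point
    refine Finset.card_bij' (fun s _ => (s * (y₀ * (s ^ 2 + d) / (s ^ 2 - d) - y₀),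
      y₀ * (s ^ 2 + d) / (s ^ 2 - d))) (fun x _ => x.1 / (x.2 - y₀)) ?_ ?_ ?_ ?_
    · intro s h
      have h' : s ^ 2 - d ≠ 0 := sub_ne_zero.2 (Finset.mem_filter.1 h).2
      rw [Finset.mem_erase, Finset.mem_filter]
      refine ⟨fun h0 => ?_, Finset.mem_univ _, ?_⟩
      · have := congrArg Prod.snd h0
        simp only at this
        rw [div_eq_iff h'] at this
        exact mul_ne_zero (mul_ne_zero h2 hd) hy (by linear_combination this)
      · simp only [hc]
        field_simp
        ring
    · intro x h
      obtain ⟨hne, hx⟩ := Finset.mem_erase.1 h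
      have hx' := (Finset.mem_filter.1 hx).2
      have h1 : x.2 - y₀ ≠ 0 := by
        intro h0
        have h3 : x.2 = y₀ := by linear_combination h0
        rw [hc, h3] at hx'
        have h4 : x.1 ^ 2 = 0 := by linear_combination hx'
        exact hne (Prod.ext (pow_eq_zero_iff two_ne_zero |>.1 h4) h3)
      rw [Finset.mem_filter]
      refine ⟨Finset.mem_univ _, fun h0 => ?_⟩
      rw [div_pow, div_eq_iff (pow_ne_zero 2 h1)] at h0
      rw [hc] at hx'
      have h5 : (2 * d * y₀) * (x.2 - y₀) = 0 := by linear_combination h0 - hx'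
      exact mul_ne_zero (mul_ne_zero (mul_ne_zero h2 hd) hy) h1 h5
    · intro s h
      have h' : s ^ 2 - d ≠ 0 := sub_ne_zero.2 (Finset.mem_filter.1 h).2
      have h6 : y₀ * (s ^ 2 + d) / (s ^ 2 - d) - y₀ ≠ 0 := by
        have : y₀ * (s ^ 2 + d) / (s ^ 2 - d) - y₀ = 2 * d * y₀ / (s ^ 2 - d) := by
          field_simp; ring
        rw [this]
        exact div_ne_zero (mul_ne_zero (mul_ne_zero h2 hd) hy) h'
      simp only
      rw [mul_div_assoc, div_self h6, mul_one]
    · intro x h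
      obtain ⟨hne, hx⟩ := Finset.mem_erase.1 h
      have hx' := (Finset.mem_filter.1 hx).2
      have h1 : x.2 - y₀ ≠ 0 := by
        intro h0
        have h3 : x.2 = y₀ := by linear_combination h0
        rw [hc, h3] at hx'
        have h4 : x.1 ^ 2 = 0 := by linear_combination hx'
        exact hne (Prod.ext (pow_eq_zero_iff two_ne_zero |>.1 h4) h3)
      rw [hc] at hx'
      have h7 : (x.1 / (x.2 - y₀)) ^ 2 - d = 2 * d * y₀ / (x.2 - y₀) := by
        field_simp
        linear_combination hx'
      have h8 : (x.1 / (x.2 - y₀)) ^ 2 + d = 2 * d * x.2 / (x.2 - y₀) := by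
        field_simp
        linear_combination hx'
      have h9 : y₀ * ((x.1 / (x.2 - y₀)) ^ 2 + d) / ((x.1 / (x.2 - y₀)) ^ 2 - d) = x.2 := by
        rw [h7, h8]
        field_simp
      ext
      · simp only [h9]
        field_simp
      · simp only [h9]
  have hmem : (0, y₀) ∈ Finset.univ.filter fun x : ZMod p × ZMod p =>
      x.1 ^ 2 - d * x.2 ^ 2 + c = 0 := by
    rw [Finset.mem_filter]
    exact ⟨Finset.mem_univ _, by simp only [hc]; ring⟩
  have h10 := Finset.card_erase_add_one hmem
  rw [← hbij] at h10
  have h11 : ({x : ZMod p | x ^ 2 = (d : ZMod p)}.toFinset).card =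
      (Finset.univ.filter fun s : ZMod p => s ^ 2 = (d : ZMod p)).card := by
    congr 1; ext; simp
  rw [h11] at hs
  rw [Finset.card_univ, ZMod.card] at hsplit
  omega

variable {p k : ℕ} [Fact p.Prime]

/-- The points of `ℤ_N²` that reduce to the conic `a² - D b² = -C` modulo `p^k`. -/
def OnConic (D C a b : ZMod (p ^ (2 * k))) : Prop :=
  (p : ZMod (p ^ (2 * k))) ^ k * (a ^ 2 - D * b ^ 2 + C) = 0

instance (D C a b : ZMod (p ^ (2 * k))) : Decidable (OnConic D C a b) :=
  inferInstanceAs (Decidable (_ = _))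

theorem onConic_mul_iff {D C a b u v : ZMod (p ^ (2 * k))} (hu : u ^ 2 = v) (hv : IsUnit v) :
    OnConic D (C * v) (a * u) (b * u) ↔ OnConic D C a b := by
  unfold OnConic
  rw [show (p : ZMod (p ^ (2 * k))) ^ k * ((a * u) ^ 2 - D * (b * u) ^ 2 + C * v) =
    v * ((p : ZMod (p ^ (2 * k))) ^ k * (a ^ 2 - D * b ^ 2 + C)) by rw [← hu]; ring,
    hv.mul_right_eq_zero]

theorem mul_two_k_pred (hk : 0 < k) : p * p ^ (2 * k - 1) = p ^ (2 * k) := by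
  rw [← pow_succ']; congr 1; omega

/-- Counting the points on the conic: scaling by square roots of `1 + p δ` shows that the lifts
of the points modulo `p` are equally distributed over the possible norms. -/
theorem card_onConic (hp : p ≠ 2) (hk : 0 < k) (D C : ZMod (p ^ (2 * k))) (d : ℤ)
    (hd : (d : ZMod p) = D.cast) (y₀ : ZMod p) (hd0 : (d : ZMod p) ≠ 0) (hy : y₀ ≠ 0)
    (hC : IsUnit C) (hc : (C.cast : ZMod p) = d * y₀ ^ 2) :
    ((Finset.univ.filter fun x : ZMod (p ^ (2 * k)) × ZMod (p ^ (2 * k)) =>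
      OnConic D C x.1 x.2).card : ℂ) = (p : ℂ) ^ (3 * k - 1) * (p - legendreSym p d) := by
  have hdvd : p ∣ p ^ (2 * k) := dvd_pow_self p (by omega)
  have hp0 : (p : ℂ) ≠ 0 := by exact_mod_cast (Fact.out : p.Prime).ne_zero
  set S := Finset.univ.filter fun x : ZMod (p ^ (2 * k)) × ZMod (p ^ (2 * k)) =>
    OnConic D C x.1 x.2 with hS
  have h1 : ∀ δ : ZMod (p ^ (2 * k)), (Finset.univ.filter
      fun x : ZMod (p ^ (2 * k)) × ZMod (p ^ (2 * k)) =>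
        OnConic D (C * (1 + p * δ)) x.1 x.2).card = S.card := by
    intro δ
    obtain ⟨ν, hν⟩ := exists_sq_eq_one_add_mul hp δ
    have hu : IsUnit (1 + p * ν) := isUnit_add_of_dvd isUnit_one (Dvd.intro _ rfl)
    have hv : IsUnit (1 + p * δ) := isUnit_add_of_dvd isUnit_one (Dvd.intro _ rfl)
    refine (Finset.card_equiv (Equiv.prodCongr hu.unit.mulRight hu.unit.mulRight) fun x => ?_).symm
    rw [hS, Finset.mem_filter, Finset.mem_filter]
    simp only [Finset.mem_univ, true_and]
    exact (onConic_mul_iff hν hv).symm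
  have h2 : ∀ a b : ZMod (p ^ (2 * k)),
      ((Finset.univ.filter fun δ => OnConic D (C * (1 + p * δ)) a b).card : ℂ) =
        if (a.cast : ZMod p) ^ 2 - d * (b.cast : ZMod p) ^ 2 + d * y₀ ^ 2 = 0
          then (p : ℂ) ^ (k + 1) else 0 := by
    intro a b
    have hcast : (a.cast : ZMod p) ^ 2 - d * (b.cast : ZMod p) ^ 2 + d * y₀ ^ 2 =
        ((a ^ 2 - D * b ^ 2 + C).cast : ZMod p) := by
      rw [← ZMod.castHom_apply (h := hdvd) (a ^ 2 - D * b ^ 2 + C)]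
      simp only [map_add, map_sub, map_mul, map_pow, ZMod.castHom_apply]
      rw [hd, hc, hd]
    rw [hcast]
    simp only [cast_eq_zero_iff_natCast_dvd hdvd]
    split_ifs with h
    · obtain ⟨m, hm⟩ := h
      have hcard := card_pow_mul_eq_zero (p := p) (n := 2 * k) (a := k + 1) (b := k - 1) (by omega)
      have : (Finset.univ.filter fun δ => OnConic D (C * (1 + p * δ)) a b).card = p ^ (k + 1) := by
        rw [← hcard]
        refine Finset.card_equiv (hC.unit.mulLeft.trans (Equiv.addRight m)) fun δ => ?_
        rw [Finset.mem_filter, Finset.mem_filter]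
        simp only [Finset.mem_univ, true_and, OnConic, Equiv.trans_apply, Units.mulLeft_apply,
          IsUnit.unit_spec, Equiv.coe_addRight]
        refine Eq.congr_left ?_
        linear_combination (p : ZMod (p ^ (2 * k))) ^ k * hm
      rw [this]; push_cast; rfl
    · rw [Finset.card_eq_zero.2, Nat.cast_zero]
      rw [Finset.filter_eq_empty_iff]
      intro δ _ hδ
      rw [OnConic, pow_mul_eq_zero_iff_dvd (b := k) (by omega)] at hδ
      have hδ' := (dvd_pow_self (p : ZMod (p ^ (2 * k))) hk.ne').trans hδ
      refine h ?_
      have := hδ'.sub (Dvd.intro (C * δ) rfl : (p : ZMod (p ^ (2 * k))) ∣ p * (C * δ))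
      exact (by ring : a ^ 2 - D * b ^ 2 + C * (1 + p * δ) - p * (C * δ) =
        a ^ 2 - D * b ^ 2 + C) ▸ this
  have h3 : ∑ δ : ZMod (p ^ (2 * k)), ((Finset.univ.filter
      fun x : ZMod (p ^ (2 * k)) × ZMod (p ^ (2 * k)) =>
        OnConic D (C * (1 + p * δ)) x.1 x.2).card : ℂ) =
      ∑ x : ZMod (p ^ (2 * k)) × ZMod (p ^ (2 * k)),
        ((Finset.univ.filter fun δ => OnConic D (C * (1 + p * δ)) x.1 x.2).card : ℂ) := by
    simp_rw [Finset.card_filter, Nat.cast_sum]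
    rw [Finset.sum_comm]
  have h4 : ∑ x : ZMod (p ^ (2 * k)) × ZMod (p ^ (2 * k)),
        ((Finset.univ.filter fun δ => OnConic D (C * (1 + p * δ)) x.1 x.2).card : ℂ) =
      ((p ^ (2 * k - 1) : ℕ) : ℂ) * (((p ^ (2 * k - 1) : ℕ) : ℂ) *
        ∑ a : ZMod p, ∑ b : ZMod p,
          if a ^ 2 - d * b ^ 2 + d * y₀ ^ 2 = 0 then (p : ℂ) ^ (k + 1) else 0) := by
    rw [Fintype.sum_prod_type]
    simp_rw [h2]
    rw [sum_comp_cast (mul_two_k_pred hk) (fun a' : ZMod p => ∑ b : ZMod (p ^ (2 * k)),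
      if a' ^ 2 - (d : ZMod p) * (b.cast : ZMod p) ^ 2 + d * y₀ ^ 2 = 0
          then (p : ℂ) ^ (k + 1) else 0)]
    congr 1
    rw [Finset.mul_sum]
    refine Finset.sum_congr rfl fun a _ => ?_
    exact sum_comp_cast (mul_two_k_pred hk) fun b : ZMod p =>
      if a ^ 2 - (d : ZMod p) * b ^ 2 + d * y₀ ^ 2 = 0 then (p : ℂ) ^ (k + 1) else 0
  have h5 : (∑ a : ZMod p, ∑ b : ZMod p,
      if a ^ 2 - d * b ^ 2 + d * y₀ ^ 2 = 0 then (p : ℂ) ^ (k + 1) else 0) =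
      (p - legendreSym p d) * (p : ℂ) ^ (k + 1) := by
    have h6 := congrArg (Int.cast : ℤ → ℂ)
      (card_conic_zmod_prime p hp d (d * y₀ ^ 2) y₀ hd0 hy rfl)
    push_cast at h6
    rw [← Fintype.sum_prod_type (f := fun x : ZMod p × ZMod p =>
      if x.1 ^ 2 - d * x.2 ^ 2 + d * y₀ ^ 2 = 0 then (p : ℂ) ^ (k + 1) else 0),
      ← Finset.sum_filter, Finset.sum_const, nsmul_eq_mul, h6]
  rw [Finset.sum_congr rfl fun δ _ => congrArg (Nat.cast : ℕ → ℂ) (h1 δ), Finset.sum_const,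
    Finset.card_univ, ZMod.card, nsmul_eq_mul] at h3
  rw [h4, h5] at h3
  push_cast at h3
  have h7 : (p : ℂ) ^ (2 * k) ≠ 0 := pow_ne_zero _ hp0
  refine mul_left_cancel₀ h7 (h3.trans ?_)
  have h8 : (p : ℂ) ^ (2 * k - 1) * ((p : ℂ) ^ (2 * k - 1) * (p : ℂ) ^ (k + 1)) =
      (p : ℂ) ^ (2 * k) * (p : ℂ) ^ (3 * k - 1) := by
    rw [← pow_add, ← pow_add, ← pow_add]; congr 1; omega
  linear_combination ((p : ℂ) - legendreSym p d) * h8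

/-- The Hecke group acts transitively on the conic modulo `p^k`. A matrix whose determinant is
`1 + p^k δ` is corrected by the scalar `1 - p^k δ / 2`. -/
theorem exists_heckeGroup_of_onConic (hp : p ≠ 2) (hk : 0 < k) {D C a b a' b' : ZMod (p ^ (2 * k))}
    (hC : IsUnit C) (h : OnConic D C a b) (h' : OnConic D C a' b') :
    ∃ g ∈ heckeGroup p k D, ∃ u v,
      a' = g.1 0 0 * a + g.1 0 1 * b + (p : ZMod (p ^ (2 * k))) ^ k * u ∧
      b' = g.1 1 0 * a + g.1 1 1 * b + (p : ZMod (p ^ (2 * k))) ^ k * v := by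
  rw [OnConic, pow_mul_eq_zero_iff_dvd (b := k) (by omega)] at h h'
  obtain ⟨m, hm⟩ := h
  obtain ⟨m', hm'⟩ := h'
  have hn : IsUnit (a ^ 2 - D * b ^ 2) := by
    have := isUnit_add_of_dvd hC.neg (z := (p : ZMod (p ^ (2 * k))) ^ k * m)
      ((dvd_pow_self _ hk.ne').trans (Dvd.intro _ rfl))
    rwa [← hm, show -C + (a ^ 2 - D * b ^ 2 + C) = a ^ 2 - D * b ^ 2 by ring] at this
  obtain ⟨ν, hν⟩ := hn.exists_right_inv
  have h2 := two_r p k hp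
  have hP := P_sq p k
  set P := (p : ZMod (p ^ (2 * k))) ^ k
  set ρ := r p k
  -- the norm of the quotient of the two points is `1 + P * δ`
  set δ := ν * (m' - m) with hδ
  have hnorm : (a ^ 2 - D * b ^ 2) * (a' ^ 2 - D * b' ^ 2) * ν ^ 2 = 1 + P * δ := by
    rw [hδ]
    linear_combination ((a' ^ 2 - D * b' ^ 2) * ν + 1) * hν + ν * (hm' - hm)
  have hdet : ((1 - P * δ * ρ) * (ν * (a * a' - D * b * b'))) ^ 2 -
      D * ((1 - P * δ * ρ) * (ν * (a * b' - b * a'))) ^ 2 = 1 := by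
    linear_combination (1 - P * δ * ρ) ^ 2 * hnorm +
      (-2 * δ ^ 2 * ρ + δ ^ 2 * ρ ^ 2 + P * δ ^ 3 * ρ ^ 2) * hP - P * δ * h2
  refine ⟨⟨!![(1 - P * δ * ρ) * (ν * (a * a' - D * b * b')),
    (1 - P * δ * ρ) * (ν * (a * b' - b * a')) * D; (1 - P * δ * ρ) * (ν * (a * b' - b * a')),
    (1 - P * δ * ρ) * (ν * (a * a' - D * b * b'))], ?_⟩, ⟨_, _, hdet, rfl⟩,
    δ * ρ * a', δ * ρ * b', ?_, ?_⟩
  · rw [Matrix.det_fin_two_of]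
    linear_combination hdet
  · simp only [Matrix.of_apply, Matrix.cons_val_zero, Matrix.cons_val_one, Matrix.cons_val',
      Matrix.cons_val_fin_one]
    linear_combination (-a' * (1 - P * δ * ρ)) * hν
  · simp only [Matrix.of_apply, Matrix.cons_val_zero, Matrix.cons_val_one, Matrix.cons_val',
      Matrix.cons_val_fin_one]
    linear_combination (-b' * (1 - P * δ * ρ)) * hν

end conic

/-! ### Coefficients of Hecke eigenfunctions -/

section hecke

variable {p k : ℕ} [Fact p.Prime]

/-- The inverse of `6` in `ℤ_N`. -/
def sixth (p k : ℕ) : ZMod (p ^ (2 * k)) := (6 : ZMod (p ^ (2 * k)))⁻¹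

theorem six_mul_sixth (hp : 3 < p) : 6 * sixth p k = 1 := by
  have h6 : Nat.Coprime 6 (p ^ (2 * k)) := by
    refine Nat.Coprime.pow_right _ ((Nat.Coprime.mul_left (m := 2) (n := 3) ?_ ?_))
    · exact (Nat.coprime_primes Nat.prime_two Fact.out).2 (by omega)
    · exact (Nat.coprime_primes Nat.prime_three Fact.out).2 (by omega)
  have := ZMod.coe_mul_inv_eq_one 6 h6
  simpa [sixth] using this

/-- First coordinate of `exp(θ √D) (a + b √D)`, with the exponential series cut off before
`θ⁴`. -/
def orbitFst (D θ a b : ZMod (p ^ (2 * k))) : ZMod (p ^ (2 * k)) :=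
  (1 + 3 * sixth p k * D * θ ^ 2) * a + (θ + sixth p k * D * θ ^ 3) * D * b

/-- Second coordinate of `exp(θ √D) (a + b √D)`, with the exponential series cut off before
`θ⁴`. -/
def orbitSnd (D θ a b : ZMod (p ^ (2 * k))) : ZMod (p ^ (2 * k)) :=
  (θ + sixth p k * D * θ ^ 3) * a + (1 + 3 * sixth p k * D * θ ^ 2) * b

/-- The element `exp(θ √D)` of the Hecke group, for `θ⁴ = 0`. -/
def expMat (hp : 3 < p) (D θ : ZMod (p ^ (2 * k))) (hθ : θ ^ 4 = 0) : SL2 p k :=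
  ⟨!![1 + 3 * sixth p k * D * θ ^ 2, (θ + sixth p k * D * θ ^ 3) * D;
    θ + sixth p k * D * θ ^ 3, 1 + 3 * sixth p k * D * θ ^ 2], by
      rw [Matrix.det_fin_two_of]
      have h6 := six_mul_sixth (k := k) hp
      linear_combination D * θ ^ 2 * h6 + (9 * sixth p k ^ 2 * D ^ 2 - 2 * sixth p k * D ^ 2 -
        sixth p k ^ 2 * D ^ 3 * θ ^ 2) * hθ⟩

theorem expMat_mem (hp : 3 < p) (D θ : ZMod (p ^ (2 * k))) (hθ : θ ^ 4 = 0) :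
    expMat hp D θ hθ ∈ heckeGroup p k D := by
  refine ⟨_, _, ?_, rfl⟩
  have h6 := six_mul_sixth (k := k) hp
  linear_combination D * θ ^ 2 * h6 + (9 * sixth p k ^ 2 * D ^ 2 - 2 * sixth p k * D ^ 2 -
        sixth p k ^ 2 * D ^ 3 * θ ^ 2) * hθ

theorem mul_pow_four_eq_zero {q : ZMod (p ^ (2 * k))} (hq : q ^ 4 = 0) (t : ZMod (p ^ (2 * k))) :
    (q * t) ^ 4 = 0 := by rw [mul_pow, hq, zero_mul]

theorem expMat_zero (hp : 3 < p) {q : ZMod (p ^ (2 * k))} (hq : q ^ 4 = 0)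
    (D : ZMod (p ^ (2 * k))) :
    expMat hp D (q * 0) (mul_pow_four_eq_zero hq 0) = 1 := by
  apply Subtype.ext
  ext i j
  fin_cases i <;> fin_cases j <;> simp [expMat]

theorem expMat_add (hp : 3 < p) {q : ZMod (p ^ (2 * k))} (hq : q ^ 4 = 0)
    (D s t : ZMod (p ^ (2 * k))) :
    expMat hp D (q * (s + t)) (mul_pow_four_eq_zero hq (s + t)) =
      expMat hp D (q * s) (mul_pow_four_eq_zero hq s) *
        expMat hp D (q * t) (mul_pow_four_eq_zero hq t) := by
  have h6 := six_mul_sixth (k := k) hp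
  set ρ := sixth p k with hρ
  have hc : 1 + 3 * ρ * D * (q * (s + t)) ^ 2 =
      (1 + 3 * ρ * D * (q * s) ^ 2) * (1 + 3 * ρ * D * (q * t) ^ 2) +
        (q * s + ρ * D * (q * s) ^ 3) * D * (q * t + ρ * D * (q * t) ^ 3) := by
    linear_combination (q ^ 2 * s * t * D) * h6 - (9 * ρ ^ 2 * D ^ 2 * s ^ 2 * t ^ 2 +
      ρ * D ^ 2 * s * t ^ 3 + ρ * D ^ 2 * s ^ 3 * t + ρ ^ 2 * D ^ 3 * q ^ 2 * s ^ 3 * t ^ 3) * hq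
  have hs : q * (s + t) + ρ * D * (q * (s + t)) ^ 3 =
      (q * s + ρ * D * (q * s) ^ 3) * (1 + 3 * ρ * D * (q * t) ^ 2) +
        (1 + 3 * ρ * D * (q * s) ^ 2) * (q * t + ρ * D * (q * t) ^ 3) := by
    linear_combination - (3 * ρ ^ 2 * D ^ 2 * q * (s ^ 3 * t ^ 2 + s ^ 2 * t ^ 3)) * hq
  apply Subtype.ext
  rw [Matrix.SpecialLinearGroup.coe_mul]
  simp only [expMat, ← hρ]
  rw [Matrix.mul_fin_two]
  ext i j
  fin_cases i <;> fin_cases j <;>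
    simp only [Fin.zero_eta, Fin.mk_one, Matrix.of_apply, Matrix.cons_val_zero,
      Matrix.cons_val_one, Matrix.cons_val', Matrix.cons_val_fin_one, Fin.isValue]
  · linear_combination hc
  · linear_combination D * hs
  · linear_combination hs
  · linear_combination hc

theorem norm_eq_one_of_weil_eq_smul (hp : p ≠ 2) {ψ : State p k} (hψ : ψ ≠ 0) {g : SL2 p k}
    {c : ℂ} (h : weil p k g ψ = c • ψ) : ‖c‖ = 1 := by
  have hpow : ∀ n : ℕ, weil p k (g ^ n) ψ = c ^ n • ψ := by
    intro n
    induction n with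
    | zero => rw [pow_zero, pow_zero, weil_one p k hp, one_smul]; rfl
    | succ n ih =>
      rw [pow_succ, weil_mul p k hp, Module.End.mul_apply, h, map_smul, ih, smul_smul, pow_succ']
  have h1 := hpow (orderOf g)
  rw [pow_orderOf_eq_one, weil_one p k hp, Module.End.one_apply] at h1
  have h2 : c ^ orderOf g = 1 := by
    have h3 : (c ^ orderOf g - 1) • ψ = 0 := by rw [sub_smul, ← h1, one_smul, sub_self]
    exact sub_eq_zero.1 ((smul_eq_zero.1 h3).resolve_right hψ)
  have h4 := congrArg norm h2
  rw [norm_pow, norm_one] at h4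
  exact (pow_eq_one_iff_of_nonneg (norm_nonneg c) (orderOf_pos g).ne').1 h4

theorem zetaCoeff_eq_zero_of_mem_V {D C : ZMod (p ^ (2 * k))} {ψ : State p k}
    (hψ : ψ ∈ V p k D C.cast) {a b : ZMod (p ^ (2 * k))} (h : ¬ OnConic D C a b) :
    zetaCoeff p k a b ψ = 0 := by
  induction hψ using Submodule.span_induction with
  | mem ψ hm =>
    obtain ⟨x, hx, rfl⟩ := hm
    refine zetaCoeff_zeta_eq_zero p k x a b ?_
    rintro ⟨u, v, rfl, rfl⟩
    refine h ?_
    have h1 : (p : ZMod (p ^ (2 * k))) ^ k * (x 0 ^ 2 - D * x 1 ^ 2 + C) = 0 := by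
      rw [pow_mul_eq_zero_iff_cast (b := k) (by omega)]
      rw [← ZMod.castHom_apply (h := dvd_N p k) (x 0 ^ 2 - D * x 1 ^ 2 + C)]
      simp only [map_add, map_sub, map_mul, map_pow, ZMod.castHom_apply]
      rw [hx, neg_add_cancel]
    unfold OnConic
    linear_combination h1 + (2 * x 0 * u - 2 * D * x 1 * v +
      (p : ZMod (p ^ (2 * k))) ^ k * (u ^ 2 - D * v ^ 2)) * P_sq p k
  | zero => exact map_zero _
  | add x y _ _ hx hy => rw [map_add, hx, hy, add_zero]
  | smul c x _ hx => rw [map_smul, hx, smul_zero]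

/-- The properties of the coefficients of a Hecke eigenfunction in `V_C` that determine its sup
norm. They are supported on the conic, where they have the constant modulus `κ`. The subgroup
`{exp(p^j t √D)}` of the Hecke group acts through the character `t ↦ e(p^j s t / N)`, and `s` is
pinned modulo `p^k` by `C`. -/
structure HeckeCoeff (j : ℕ) (D C s : ZMod (p ^ (2 * k))) (κ : ℝ)
    (F : ZMod (p ^ (2 * k)) → ZMod (p ^ (2 * k)) → ℂ) : Prop where
  add : ∀ a b u v, F (a + (p : ZMod (p ^ (2 * k))) ^ k * u) (b + (p : ZMod (p ^ (2 * k))) ^ k * v) =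
    e ((p : ZMod (p ^ (2 * k))) ^ k * a * v) * F a b
  eq_zero : ∀ a b, ¬ OnConic D C a b → F a b = 0
  norm_eq : ∀ a b, OnConic D C a b → ‖F a b‖ = κ
  orbit : ∀ a b t, F (orbitFst D ((p : ZMod (p ^ (2 * k))) ^ j * t) a b)
      (orbitSnd D ((p : ZMod (p ^ (2 * k))) ^ j * t) a b) =
    e (r p k * (orbitFst D ((p : ZMod (p ^ (2 * k))) ^ j * t) a b *
      orbitSnd D ((p : ZMod (p ^ (2 * k))) ^ j * t) a b - a * b) -
        (p : ZMod (p ^ (2 * k))) ^ j * s * t) * F a b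
  weight : (p : ZMod (p ^ (2 * k))) ^ k * (2 * s - C) = 0

theorem exists_heckeCoeff (hp : 3 < p) (hk : 0 < k) {j : ℕ} (hj : k ≤ 2 * j) (hjk : j ≤ k)
    {D C : ZMod (p ^ (2 * k))} (hC : IsUnit C) {ψ : State p k} (hψ : ψ ∈ V p k D C.cast)
    (hH : IsHeckeEigenfunction p k D ψ) :
    ∃ s κ, 0 ≤ κ ∧ HeckeCoeff j D C s κ fun a b => zetaCoeff p k a b ψ := by
  have hp2 : p ≠ 2 := by omega
  obtain ⟨hψ0, hH⟩ := hH
  obtain ⟨y, hy⟩ : ∃ y, ψ y ≠ 0 := by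
    by_contra! h
    exact hψ0 (funext h)
  obtain ⟨x, hx⟩ : ∃ x, zetaCoeff p k x y ψ ≠ 0 := by
    by_contra! h
    have h1 := sum_zetaCoeff p k y ψ
    rw [Finset.sum_eq_zero fun a _ => h a] at h1
    exact mul_ne_zero (pow_ne_zero _ (by exact_mod_cast (Fact.out : p.Prime).ne_zero)) hy h1.symm
  have hxy : OnConic D C x y := by
    by_contra h
    exact hx (zetaCoeff_eq_zero_of_mem_V hψ h)
  set P := (p : ZMod (p ^ (2 * k))) ^ k with hPdef
  set q := (p : ZMod (p ^ (2 * k))) ^ j with hqdef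
  have hq4 : q ^ 4 = 0 := by rw [hqdef, ← pow_mul]; exact pow_eq_zero_of_le_exp (by omega)
  -- the character by which the elements `exp(q t √D)` act
  choose χ hχ using fun t => hH _ (expMat_mem hp D (q * t) (mul_pow_four_eq_zero hq4 t))
  have hinj : ∀ c d : ℂ, c • ψ = d • ψ → c = d := fun c d h => smul_left_injective ℂ hψ0 h
  have hχ0 : χ 0 = 1 := by
    refine hinj _ _ ?_
    rw [← hχ, expMat_zero hp hq4, weil_one p k hp2, one_smul]; rfl
  have hχa : ∀ t u, χ (t + u) = χ t * χ u := by
    intro t u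
    refine hinj _ _ ?_
    rw [← hχ, expMat_add hp hq4, weil_mul p k hp2, Module.End.mul_apply, hχ u, map_smul, hχ t,
      smul_smul]
    congr 1
    exact mul_comm _ _
  obtain ⟨σ, hσ⟩ := exists_eq_e_mul (⟨χ, hχ0, hχa⟩ : AddChar (ZMod (p ^ (2 * k))) ℂ)
  have hσ' : ∀ t, χ t = e (σ * t) := hσ
  have horb : ∀ a b t, zetaCoeff p k (orbitFst D (q * t) a b) (orbitSnd D (q * t) a b) ψ =
      e (r p k * (orbitFst D (q * t) a b * orbitSnd D (q * t) a b - a * b) - σ * t) *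
        zetaCoeff p k a b ψ := by
    intro a b t
    have h1 := zetaCoeff_weil p k hp2 (expMat hp D (q * t) (mul_pow_four_eq_zero hq4 t)) a b ψ
    rw [hχ, map_smul, hσ', smul_eq_mul] at h1
    change e (σ * t) * zetaCoeff p k (orbitFst D (q * t) a b) (orbitSnd D (q * t) a b) ψ =
      e (r p k * (orbitFst D (q * t) a b * orbitSnd D (q * t) a b - a * b)) *
        zetaCoeff p k a b ψ at h1
    rw [sub_eq_add_neg, e_add, mul_right_comm, ← h1]
    linear_combination (-zetaCoeff p k (orbitFst D (q * t) a b) (orbitSnd D (q * t) a b) ψ) *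
      e_neg_mul (σ * t)
  have h2 := two_r p k hp2
  have hP := P_sq p k
  -- elements congruent to `1` modulo `p ^ k` act on each coefficient by a phase, which pins `σ`
  have hpin : (p : ZMod (p ^ (2 * k))) ^ (k - j) * (σ - q * (r p k * C)) = 0 := by
    refine eq_zero_of_forall_e_mul fun β => ?_
    have h3 := horb x y ((p : ZMod (p ^ (2 * k))) ^ (k - j) * β)
    have hqP : q * ((p : ZMod (p ^ (2 * k))) ^ (k - j) * β) = P * β := by
      rw [← mul_assoc, ← pow_add]; congr 2; omega
    rw [hqP] at h3
    have hfst : orbitFst D (P * β) x y = x + P * (β * D * y) := by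
      unfold orbitFst
      linear_combination (3 * sixth p k * D * β ^ 2 * x + sixth p k * D ^ 2 * β ^ 3 * y * P) * hP
    have hsnd : orbitSnd D (P * β) x y = y + P * (β * x) := by
      unfold orbitSnd
      linear_combination (3 * sixth p k * D * β ^ 2 * y + sixth p k * D * β ^ 3 * x * P) * hP
    rw [hfst, hsnd, zetaCoeff_add] at h3
    have h4 := mul_right_cancel₀ hx h3
    have h5 : e (P * x * (β * x) - (r p k * ((x + P * (β * D * y)) * (y + P * (β * x)) - x * y) -
        σ * ((p : ZMod (p ^ (2 * k))) ^ (k - j) * β))) = 1 := by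
      rw [sub_eq_add_neg, e_add, h4, mul_comm, e_neg_mul]
    rw [← h5]
    congr 1
    have hxy' : P * (x ^ 2 - D * y ^ 2 + C) = 0 := hxy
    have hqP' : (p : ZMod (p ^ (2 * k))) ^ (k - j) * q = P := by
      rw [← pow_add]; congr 1; omega
    linear_combination (-(r p k * C * β)) * hqP' - (r p k * β) * hxy' +
      (r p k * β ^ 2 * D * y * x) * hP + (P * β * x ^ 2) * h2
  rw [pow_mul_eq_zero_iff_dvd (b := k + j) (by omega)] at hpin
  obtain ⟨w, hw⟩ := hpin
  have hσs : σ = q * (r p k * C + P * w) := by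
    rw [pow_add] at hw
    linear_combination hw
  refine ⟨r p k * C + P * w, ‖zetaCoeff p k x y ψ‖, norm_nonneg _, fun a b u v => zetaCoeff_add p k a b u v ψ,
    fun a b h => zetaCoeff_eq_zero_of_mem_V hψ h, fun a b h => ?_, fun a b t => ?_, ?_⟩
  · obtain ⟨g, hg, u, v, rfl, rfl⟩ := exists_heckeGroup_of_onConic hp2 hk hC hxy h
    obtain ⟨c, hc⟩ := hH g hg
    have h1 := zetaCoeff_weil p k hp2 g x y ψ
    rw [hc, map_smul, smul_eq_mul] at h1
    have h3 := congrArg norm h1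
    rw [norm_mul, norm_mul, norm_eq_one_of_weil_eq_smul hp2 hψ0 hc, norm_e, one_mul, one_mul] at h3
    simp only [zetaCoeff_add, norm_mul, norm_e, one_mul, h3]
  · rw [horb, hσs]
  · linear_combination 2 * w * hP + P * C * h2

/-- The common modulus of the coefficients on the conic, for a normalized eigenfunction. -/
theorem heckeCoeff_norm (hp : p ≠ 2) (hk : 0 < k) {j : ℕ} {D C s : ZMod (p ^ (2 * k))} {κ : ℝ}
    (hC : IsUnit C) (d : ℤ) (hd : (d : ZMod p) = D.cast) (y₀ : ZMod p) (hd0 : (d : ZMod p) ≠ 0)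
    (hy : y₀ ≠ 0) (hc : (C.cast : ZMod p) = d * y₀ ^ 2) {ψ : State p k}
    (h : HeckeCoeff j D C s κ fun a b => zetaCoeff p k a b ψ) (hψ : l2Norm p k ψ = 1)
    (hκ : 0 ≤ κ) :
    κ = (p : ℝ) ^ (2 * k) * (1 / √(1 - (legendreSym p d : ℝ) * (1 / (p : ℝ)))) := by
  have hp0 : (0 : ℝ) < p := by exact_mod_cast (Fact.out : p.Prime).pos
  have hcard : ((Finset.univ.filter fun x : ZMod (p ^ (2 * k)) × ZMod (p ^ (2 * k)) =>
      OnConic D C x.1 x.2).card : ℝ) = (p : ℝ) ^ (3 * k - 1) * (p - legendreSym p d) := by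
    exact_mod_cast card_onConic hp hk D C d hd y₀ hd0 hy hC hc
  have h1 : ∑ a, ∑ b, ‖zetaCoeff p k a b ψ‖ ^ 2 =
      (p : ℝ) ^ (3 * k - 1) * (p - legendreSym p d) * κ ^ 2 := by
    rw [← Fintype.sum_prod_type (f := fun x : ZMod (p ^ (2 * k)) × ZMod (p ^ (2 * k)) =>
      ‖zetaCoeff p k x.1 x.2 ψ‖ ^ 2), ← hcard, ← nsmul_eq_mul, ← Finset.sum_const,
      Finset.sum_filter]
    refine Finset.sum_congr rfl fun x _ => ?_
    split_ifs with hx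
    · rw [h.norm_eq _ _ hx]
    · have := h.eq_zero _ _ hx
      rw [this, norm_zero, zero_pow two_ne_zero]
  rw [sum_norm_sq_zetaCoeff] at h1
  have h2 : ∑ y, ‖ψ y‖ ^ 2 = (p : ℝ) ^ (2 * k) := by
    have := (Real.sqrt_eq_one).1 hψ
    field_simp at this
    exact this
  have hε : (0 : ℝ) < 1 - (legendreSym p d : ℝ) * (1 / (p : ℝ)) := by
    have h3 : (legendreSym p d : ℝ) ≤ 1 := by
      rcases legendreSym.eq_one_or_neg_one p hd0 with h | h <;> rw [h] <;> norm_num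
    have h4 : (1 : ℝ) < p := by exact_mod_cast (Fact.out : p.Prime).one_lt
    rw [mul_one_div, sub_pos, div_lt_one hp0]
    linarith
  have h5 : κ ^ 2 = ((p : ℝ) ^ (2 * k) *
      (1 / √(1 - (legendreSym p d : ℝ) * (1 / (p : ℝ))))) ^ 2 := by
    rw [mul_pow, div_pow, Real.sq_sqrt hε.le]
    rw [h2] at h1
    have h6 : (p : ℝ) ^ (3 * k - 1) * p = (p : ℝ) ^ (3 * k) := by
      rw [← pow_succ]; congr 1; omega
    have h7 : (p : ℝ) ^ (3 * k - 1) * (p - legendreSym p d) =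
        (p : ℝ) ^ (3 * k) * (1 - (legendreSym p d : ℝ) * (1 / (p : ℝ))) := by
      rw [← h6]; field_simp
    rw [h7] at h1
    have h8 : (p : ℝ) ^ (3 * k) ≠ 0 := by positivity
    have h9 : (p : ℝ) ^ (5 * k) * (p : ℝ) ^ (2 * k) =
        (p : ℝ) ^ (3 * k) * ((p : ℝ) ^ (2 * k)) ^ 2 := by
      rw [← pow_mul, ← pow_add, ← pow_add]; congr 1; ring
    rw [h9, mul_assoc] at h1
    have h10 := mul_left_cancel₀ h8 h1
    rw [h10, one_pow, mul_one_div, mul_div_assoc, mul_comm, div_mul_cancel₀ _ hε.ne']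
  exact (pow_left_inj₀ hκ (by positivity) two_ne_zero).1 h5

end hecke

/-! ### Cubic exponential sums modulo prime powers -/

section cubic

variable {p n : ℕ} [Fact p.Prime]

/-- The complete exponential sum of the cubic polynomial `α t + β t² + γ t³`. -/
def cubicSum (α β γ : ZMod (p ^ n)) : ℂ := ∑ t, e (α * t + β * t ^ 2 + γ * t ^ 3)

/-- Shifting the variable by the annihilator of `p^m` shows that the linear coefficient of a
nonzero sum is divisible by every power `p^m` that divides the other two. -/
theorem pow_dvd_of_cubicSum_ne_zero {m : ℕ} (hm : m ≤ n) {α β γ : ZMod (p ^ n)}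
    (hβ : (p : ZMod (p ^ n)) ^ m ∣ β) (hγ : (p : ZMod (p ^ n)) ^ m ∣ γ)
    (h : cubicSum α β γ ≠ 0) : (p : ZMod (p ^ n)) ^ m ∣ α := by
  refine pow_dvd_of_forall_e_mul hm fun s hs => ?_
  obtain ⟨β', rfl⟩ := hβ
  obtain ⟨γ', rfl⟩ := hγ
  have h1 : cubicSum α ((p : ZMod (p ^ n)) ^ m * β') ((p : ZMod (p ^ n)) ^ m * γ') =
      e (α * s) * cubicSum α ((p : ZMod (p ^ n)) ^ m * β') ((p : ZMod (p ^ n)) ^ m * γ') := by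
    conv_lhs => rw [cubicSum, ← Equiv.sum_comp (Equiv.addRight s)]
    rw [cubicSum, Finset.mul_sum]
    refine Finset.sum_congr rfl fun t _ => ?_
    rw [← e_add, Equiv.coe_addRight]
    congr 1
    linear_combination (β' * (2 * t + s) + γ' * (3 * t ^ 2 + 3 * t * s + s ^ 2)) * hs
  exact mul_right_cancel₀ h (by rw [one_mul]; exact h1.symm)

/-- A cubic sum that is, up to the factor `p^m`, a nondegenerate quadratic polynomial plus a
multiple of `p` has square root cancellation. -/
theorem norm_cubicSum_sq_le (hp : p ≠ 2) {m : ℕ} (hm : m ≤ n) (α : ZMod (p ^ n))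
    {u γ : ZMod (p ^ n)} (hu : IsUnit u) :
    ‖cubicSum α ((p : ZMod (p ^ n)) ^ m * u) ((p : ZMod (p ^ n)) ^ (m + 1) * γ)‖ ^ 2 ≤
      (p : ℝ) ^ n * (p : ℝ) ^ m := by
  have h2 : IsUnit (2 : ZMod (p ^ n)) := isUnit_two hp
  set W : ZMod (p ^ n) → ZMod (p ^ n) := fun t =>
    α * t + ((p : ZMod (p ^ n)) ^ m * u) * t ^ 2 + ((p : ZMod (p ^ n)) ^ (m + 1) * γ) * t ^ 3
    with hW
  have h1 : ((‖cubicSum α ((p : ZMod (p ^ n)) ^ m * u) ((p : ZMod (p ^ n)) ^ (m + 1) * γ)‖ ^ 2 : ℝ)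
      : ℂ) = ∑ s, ∑ t, e (W (t + s) + -W t) := by
    push_cast
    rw [← Complex.mul_conj', cubicSum, map_sum, Finset.sum_mul_sum, Finset.sum_comm,
      Finset.sum_comm (f := fun s t => e (W (t + s) + -W t))]
    refine Finset.sum_congr rfl fun t _ => ?_
    rw [← Equiv.sum_comp (Equiv.addLeft t)]
    refine Finset.sum_congr rfl fun s _ => ?_
    change e (W (t + s)) * (starRingEnd ℂ) (e (W t)) = _
    rw [← e_neg, ← e_add]
  have h3 : ∀ s, ∑ t, e (W (t + s) + -W t) =
      if (p : ZMod (p ^ n)) ^ m * s = 0 then e (W s) * (p : ℂ) ^ n else 0 := by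
    intro s
    have hb : Function.Bijective fun t : ZMod (p ^ n) =>
        (2 * u + (p : ZMod (p ^ n)) * (3 * γ * s)) * t + (p : ZMod (p ^ n)) * (3 * γ) * t ^ 2 :=
      bijective_of_sub_eq_unit_mul fun t t' =>
        ⟨2 * u + p * (3 * γ * s + 3 * γ * (t + t')),
          isUnit_add_of_dvd (h2.mul hu) (Dvd.intro _ rfl), by ring⟩
    have h4 : ∀ t, e (W (t + s) + -W t) = e (W s) * e ((p : ZMod (p ^ n)) ^ m * s *
        ((2 * u + (p : ZMod (p ^ n)) * (3 * γ * s)) * t + (p : ZMod (p ^ n)) * (3 * γ) * t ^ 2)) := by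
      intro t
      rw [← e_add]
      congr 1
      simp only [hW]
      ring
    rw [Finset.sum_congr rfl fun t _ => h4 t, ← Finset.mul_sum,
      hb.sum_comp (fun τ => e ((p : ZMod (p ^ n)) ^ m * s * τ)), sum_e_mul]
    split_ifs <;> simp
  have h5 : ‖((‖cubicSum α ((p : ZMod (p ^ n)) ^ m * u)
      ((p : ZMod (p ^ n)) ^ (m + 1) * γ)‖ ^ 2 : ℝ) : ℂ)‖ ≤ (p : ℝ) ^ n * (p : ℝ) ^ m := by
    rw [h1, Finset.sum_congr rfl fun s _ => h3 s, ← Finset.sum_filter]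
    refine (norm_sum_le _ _).trans (le_of_eq ?_)
    simp_rw [norm_mul, norm_e, one_mul]
    rw [Finset.sum_const, card_pow_mul_eq_zero (b := n - m) (by omega), nsmul_eq_mul, norm_pow,
      Complex.norm_natCast]
    push_cast
    ring
  rwa [Complex.norm_real, Real.norm_of_nonneg (by positivity)] at h5

end cubic

/-! ### Sums over classes of coefficients -/

section classSum

variable {p k : ℕ} [Fact p.Prime]

theorem orbit_norm {q : ZMod (p ^ (2 * k))} (hp : 3 < p) (hq : q ^ 4 = 0)
    (D t a b : ZMod (p ^ (2 * k))) :
    orbitFst D (q * t) a b ^ 2 - D * orbitSnd D (q * t) a b ^ 2 = a ^ 2 - D * b ^ 2 := by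
  obtain ⟨u, v, huv, hg⟩ := expMat_mem hp D (q * t) (mul_pow_four_eq_zero hq t)
  have hu : u = 1 + 3 * sixth p k * D * (q * t) ^ 2 := (congrFun (congrFun hg 0) 0).symm
  have hv : v = q * t + sixth p k * D * (q * t) ^ 3 := (congrFun (congrFun hg 1) 0).symm
  unfold orbitFst orbitSnd
  rw [← hu, ← hv]
  linear_combination (a ^ 2 - D * b ^ 2) * huv

/-- The sum of the coefficients over a class `x + p^j R`, for fixed second coordinate, is a cubic
exponential sum. The class is parametrized by the orbit of `exp(p^j t √D)`; the points of the orbit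
whose second coordinate differs from `y` modulo `p^k` contribute nothing to the exponential sum,
as one sees from shifts of `t` by multiples of `p^(k - j)`. -/
theorem HeckeCoeff.sum_class (hp : 3 < p) {j : ℕ} (hj : 0 < j) (hjk : j ≤ k) (h3j : k ≤ 3 * j)
    (h4j : 2 * k ≤ 4 * j) {D C s : ZMod (p ^ (2 * k))} {κ : ℝ}
    {F : ZMod (p ^ (2 * k)) → ZMod (p ^ (2 * k)) → ℂ} (h : HeckeCoeff j D C s κ F)
    {a y : ZMod (p ^ (2 * k))} (hD : IsUnit D) (hy : IsUnit y) (ha : OnConic D C a y) :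
    ∑ τ, F (a + (p : ZMod (p ^ (2 * k))) ^ j * τ) y = F a y *
      cubicSum ((p : ZMod (p ^ (2 * k))) ^ j * (-s + r p k * D * y ^ 2 - r p k * a ^ 2))
        (-((p : ZMod (p ^ (2 * k))) ^ (2 * j) * (r p k * D * a * y)))
        (-((p : ZMod (p ^ (2 * k))) ^ (3 * j) *
          (sixth p k * D ^ 2 * y ^ 2 + 2 * sixth p k * D * a ^ 2))) := by
  have h2 := two_r p k (by omega : p ≠ 2)
  have h6 := six_mul_sixth (k := k) hp
  have hP := P_sq p k
  have hw := h.weight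
  have hpq : (p : ZMod (p ^ (2 * k))) ∣ (p : ZMod (p ^ (2 * k))) ^ j := dvd_pow_self _ hj.ne'
  have hq4 : ((p : ZMod (p ^ (2 * k))) ^ j) ^ 4 = 0 := by
    rw [← pow_mul]; exact pow_eq_zero_of_le_exp (by omega)
  have hPq3 : (p : ZMod (p ^ (2 * k))) ^ k * ((p : ZMod (p ^ (2 * k))) ^ j) ^ 3 = 0 := by
    rw [← pow_mul, ← pow_add]; exact pow_eq_zero_of_le_exp (by omega)
  have hqP : ∀ t β, (p : ZMod (p ^ (2 * k))) ^ j * (t + (p : ZMod (p ^ (2 * k))) ^ (k - j) * β) =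
      (p : ZMod (p ^ (2 * k))) ^ j * t + (p : ZMod (p ^ (2 * k))) ^ k * β := by
    intro t β
    rw [mul_add, ← mul_assoc, ← pow_add]; congr 3; omega
  have hpow2 : (p : ZMod (p ^ (2 * k))) ^ (2 * j) = ((p : ZMod (p ^ (2 * k))) ^ j) ^ 2 := pow_mul' _ _ _
  have hpow3 : (p : ZMod (p ^ (2 * k))) ^ (3 * j) = ((p : ZMod (p ^ (2 * k))) ^ j) ^ 3 := pow_mul' _ _ _
  have horb := h.orbit a y
  set P := (p : ZMod (p ^ (2 * k))) ^ k with hPdef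
  set q := (p : ZMod (p ^ (2 * k))) ^ j with hqdef
  set X := fun t => orbitFst D (q * t) a y with hX
  set Z := fun t => orbitSnd D (q * t) a y with hZ
  set M := fun t => r p k * (X t * Z t - a * y) - q * s * t + X t * (y - Z t) with hM
  have hconic : ∀ t, P * (X t ^ 2 - D * Z t ^ 2 + C) = 0 := by
    intro t
    rw [show X t ^ 2 - D * Z t ^ 2 = a ^ 2 - D * y ^ 2 from orbit_norm hp hq4 D t a y]
    exact ha
  have hZunit : ∀ t, IsUnit (Z t) := by
    intro t
    have : Z t = y + q * (t * a + 3 * sixth p k * D * q * t ^ 2 * y +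
        sixth p k * D * q ^ 2 * t ^ 3 * a) := by
      simp only [hZ, orbitSnd]; ring
    rw [this]
    exact isUnit_add_of_dvd hy (hpq.mul_right _)
  have hZy : ∀ t, IsUnit (Z t + y) := by
    intro t
    have : Z t + y = 2 * y + q * (t * a + 3 * sixth p k * D * q * t ^ 2 * y +
        sixth p k * D * q ^ 2 * t ^ 3 * a) := by
      simp only [hZ, orbitSnd]; ring
    rw [this]
    exact isUnit_add_of_dvd ((IsUnit.of_mul_eq_one _ h2).mul hy) (hpq.mul_right _)
  have hbij : Function.Bijective fun t => D * y * t + 3 * sixth p k * D * a * q * t ^ 2 +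
      sixth p k * D ^ 2 * y * q ^ 2 * t ^ 3 :=
    bijective_of_sub_eq_unit_mul fun t t' => ⟨D * y + q * (3 * sixth p k * D * a * (t + t') +
      sixth p k * D ^ 2 * y * q * (t ^ 2 + t * t' + t' ^ 2)),
      isUnit_add_of_dvd (hD.mul hy) (hpq.mul_right _), by ring⟩
  have hFX : ∀ t, F (X t) y = if P * (D * Z t * (y - Z t)) = 0 then F a y * e (M t) else 0 := by
    intro t
    have hiff : P * (D * Z t * (y - Z t)) = 0 ↔ P * (y - Z t) = 0 := by
      rw [show P * (D * Z t * (y - Z t)) = D * Z t * (P * (y - Z t)) by ring,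
        (hD.mul (hZunit t)).mul_right_eq_zero]
    rw [if_congr hiff rfl rfl]
    split_ifs with h0
    · rw [hPdef, pow_mul_eq_zero_iff_dvd (b := k) (by omega)] at h0
      obtain ⟨v, hv⟩ := h0
      have h7 := h.add (X t) (Z t) 0 v
      rw [mul_zero, add_zero, ← hPdef, ← eq_add_of_sub_eq' hv, horb] at h7
      rw [h7, ← mul_assoc, ← e_add, mul_comm]
      congr 2
      simp only [hM, hv]
      ring
    · refine h.eq_zero _ _ fun hc => h0 ?_
      rw [OnConic, ← hPdef] at hc
      rw [← (hD.mul (hZy t)).mul_right_eq_zero]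
      linear_combination hconic t - hc
  have hMshift : ∀ t β, M (t + (p : ZMod (p ^ (2 * k))) ^ (k - j) * β) =
      M t + P * (D * Z t * (y - Z t)) * β := by
    intro t β
    have hX' : X (t + (p : ZMod (p ^ (2 * k))) ^ (k - j) * β) = X t + P * β * (D * Z t) := by
      simp only [hX, hZ, orbitFst, orbitSnd, hqP]
      linear_combination (P * β * D * q * t * a) * h6 -
        (β * D ^ 2 * sixth p k * t ^ 3 * a) * hPq3 +
        (3 * sixth p k * D * β ^ 2 * a + sixth p k * D ^ 2 * y * β ^ 2 * (3 * q * t + P * β)) * hP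
    have hZ' : Z (t + (p : ZMod (p ^ (2 * k))) ^ (k - j) * β) = Z t + P * β * X t := by
      simp only [hX, hZ, orbitFst, orbitSnd, hqP]
      linear_combination (P * β * D * q * t * y) * h6 -
        (β * D ^ 2 * sixth p k * t ^ 3 * y) * hPq3 +
        (3 * sixth p k * D * β ^ 2 * y + sixth p k * D * a * β ^ 2 * (3 * q * t + P * β)) * hP
    have hqs : q * s * (t + (p : ZMod (p ^ (2 * k))) ^ (k - j) * β) = q * s * t + P * β * s := by
      linear_combination s * hqP t β
    simp only [hM, hX', hZ', hqs]
    linear_combination (r p k - 1) * (β ^ 2 * D * Z t * X t) * hP - r p k * β * hconic t -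
      r p k * β * hw + (P * β * s) * h2 +
      (P * β * (X t ^ 2)) * h2
  have hM0 : ∀ t, M t = q * (-s + r p k * D * y ^ 2 - r p k * a ^ 2) * t +
      -(q ^ 2 * (r p k * D * a * y)) * t ^ 2 +
      -(q ^ 3 * (sixth p k * D ^ 2 * y ^ 2 + 2 * sixth p k * D * a ^ 2)) * t ^ 3 := by
    intro t
    simp only [hM, hX, hZ, orbitFst, orbitSnd]
    linear_combination (-a * y - D * y ^ 2 * q * t - 2 * sixth p k * D * (q * t) ^ 3 *
      (a ^ 2 + D * y ^ 2) - 3 * sixth p k * D * a * y * (q * t) ^ 2) * h2 +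
      (((1 + 3 * sixth p k * D * (q * t) ^ 2) * a + (q * t + sixth p k * D * (q * t) ^ 3) * D * y) *
        ((q * t + sixth p k * D * (q * t) ^ 3) * a +
          (1 + 3 * sixth p k * D * (q * t) ^ 2) * y)) * h2 -
      r p k * t ^ 4 * (3 * sixth p k ^ 2 * D ^ 2 * (q * t) * (a ^ 2 + D * y ^ 2) +
        (9 * sixth p k ^ 2 * D ^ 2 + 2 * sixth p k * D ^ 2 +
          sixth p k ^ 2 * D ^ 3 * (q * t) ^ 2) * (a * y)) * hq4
  have hsum : ∑ t, F (X t) y = F a y * ∑ t, e (M t) := by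
    have hN : ((p : ℂ) ^ (2 * k)) ≠ 0 :=
      pow_ne_zero _ (by exact_mod_cast (Fact.out : p.Prime).ne_zero)
    refine mul_left_cancel₀ hN ?_
    have h8 : (p : ℂ) ^ (2 * k) * ∑ t, e (M t) =
        ∑ t, if P * (D * Z t * (y - Z t)) = 0 then (p : ℂ) ^ (2 * k) * e (M t) else 0 := by
      have h9 := sum_sum_add_mul ((p : ZMod (p ^ (2 * k))) ^ (k - j)) fun t => e (M t)
      push_cast at h9
      rw [← h9]
      refine Finset.sum_congr rfl fun t _ => ?_
      simp_rw [hMshift, e_add]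
      rw [← Finset.mul_sum, sum_e_mul]
      split_ifs
      · push_cast; ring
      · rw [mul_zero]
    rw [mul_left_comm, h8, Finset.mul_sum, Finset.mul_sum]
    refine Finset.sum_congr rfl fun t _ => ?_
    rw [hFX]
    split_ifs
    · ring
    · ring
  rw [hpow2, hpow3, cubicSum, ← Finset.sum_congr rfl fun t _ => congrArg e (hM0 t), ← hsum,
    ← hbij.sum_comp (fun τ => F (a + q * τ) y)]
  refine Finset.sum_congr rfl fun t _ => ?_
  congr 1
  simp only [hX, orbitFst]
  ring

end classSum

/-! ### The classes that contribute to a value -/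

section squares

variable {p n : ℕ} [Fact p.Prime]

theorem pow_dvd_sub_or_pow_dvd_add (hp : p ≠ 2) {m : ℕ} {u v : ZMod (p ^ n)} (hu : IsUnit u)
    (h : (p : ZMod (p ^ n)) ^ m ∣ v ^ 2 - u ^ 2) :
    (p : ZMod (p ^ n)) ^ m ∣ v - u ∨ (p : ZMod (p ^ n)) ^ m ∣ v + u := by
  rw [show v ^ 2 - u ^ 2 = (v - u) * (v + u) by ring] at h
  rcases isUnit_or_dvd (v - u) with h1 | h1
  · exact Or.inr ((h1.dvd_mul_left).1 h)
  · refine Or.inl ?_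
    have h2 := isUnit_add_of_dvd ((isUnit_two hp).mul hu) h1
    rw [show 2 * u + (v - u) = v + u by ring] at h2
    exact (h2.dvd_mul_right).1 h

/-- Two residues whose squares are close are close up to sign: the precision `2 j + l` allowed for
`p^j (b² - a²)` grows with the common divisor `p^l` of `a` and `b`. -/
theorem pow_dvd_sub_or_add_of_pow_dvd_sq_sub (hp : p ≠ 2) {j : ℕ} (hj : 3 * j ≤ n)
    {a b : ZMod (p ^ n)} (ha : ¬ (p : ZMod (p ^ n)) ^ j ∣ a)
    (h : ∀ l ≤ j, (p : ZMod (p ^ n)) ^ l ∣ a → (p : ZMod (p ^ n)) ^ l ∣ b →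
      (p : ZMod (p ^ n)) ^ (2 * j + l) ∣ (p : ZMod (p ^ n)) ^ j * (b ^ 2 - a ^ 2)) :
    (p : ZMod (p ^ n)) ^ j ∣ b - a ∨ (p : ZMod (p ^ n)) ^ j ∣ b + a := by
  obtain ⟨l, hl, u, hu, rfl⟩ := (pow_dvd_or_exists_isUnit j a).resolve_left ha
  -- a square times a unit is not divisible by more than the valuation allows
  have key : ∀ (i : ℕ) (w v : ZMod (p ^ n)), i < j → IsUnit w →
      ¬ (p : ZMod (p ^ n)) ^ (2 * j + i) ∣
        (p : ZMod (p ^ n)) ^ j * (((p : ZMod (p ^ n)) ^ (i + 1) * v) ^ 2 -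
          ((p : ZMod (p ^ n)) ^ i * w) ^ 2) := by
    intro i w v hi hw hd
    refine not_pow_dvd_pow_mul_of_isUnit (a := j + 2 * i) (b := 2 * j + i) (by omega) (by omega)
      (isUnit_add_of_dvd (hw.pow 2).neg (z := (p : ZMod (p ^ n)) * ((p : ZMod (p ^ n)) * v ^ 2))
        (Dvd.intro _ rfl)) ?_
    convert hd using 1
    ring
  by_cases hb : (p : ZMod (p ^ n)) ^ (l + 1) ∣ b
  · obtain ⟨v, rfl⟩ := hb
    exact absurd (h l hl.le (Dvd.intro _ rfl) ((pow_dvd_pow _ (Nat.le_succ l)).trans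
      (Dvd.intro _ rfl))) (key l u v hl hu)
  · obtain ⟨i, hi, v, hv, rfl⟩ := (pow_dvd_or_exists_isUnit (l + 1) b).resolve_left hb
    rcases Nat.lt_or_ge i l with hil | hil
    · obtain ⟨c, rfl⟩ := Nat.exists_eq_add_of_lt hil
      have h1 := h i (by omega) ((pow_dvd_pow _ (by omega)).trans (Dvd.intro _ rfl))
        (Dvd.intro _ rfl)
      rw [← dvd_neg] at h1
      refine absurd ?_ (key i v ((p : ZMod (p ^ n)) ^ c * u) (by omega) hv)
      convert h1 using 1
      ring
    · obtain rfl : i = l := by omega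
      have h1 := h i hl.le (Dvd.intro _ rfl) (Dvd.intro _ rfl)
      have h2 : (p : ZMod (p ^ n)) ^ ((j + 2 * i) + (j - i)) ∣
          (p : ZMod (p ^ n)) ^ (j + 2 * i) * (v ^ 2 - u ^ 2) := by
        convert h1 using 1
        · congr 1; omega
        · ring
      have h3 : (p : ZMod (p ^ n)) ^ j = p ^ i * p ^ (j - i) := by
        rw [← pow_add]; congr 1; omega
      rw [← mul_sub, ← mul_add, h3]
      exact (pow_dvd_sub_or_pow_dvd_add hp hu
        (pow_dvd_of_pow_dvd_pow_mul (by omega) h2)).imp (mul_dvd_mul_left _) (mul_dvd_mul_left _)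

theorem card_pow_dvd_sub {m : ℕ} (hm : m ≤ n) (a : ZMod (p ^ n)) [DecidablePred fun b : ZMod (p ^ n)
    => (p : ZMod (p ^ n)) ^ m ∣ b - a] :
    (Finset.univ.filter fun b : ZMod (p ^ n) => (p : ZMod (p ^ n)) ^ m ∣ b - a).card =
      p ^ (n - m) := by
  rw [← card_pow_mul_eq_zero (p := p) (n := n) (a := n - m) (b := m) (by omega)]
  refine Finset.card_equiv (Equiv.subRight a) fun b => ?_
  rw [Finset.mem_filter, Finset.mem_filter, Equiv.subRight_apply,
    pow_mul_eq_zero_iff_dvd (b := m) (by omega)]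
  simp

theorem norm_sum_le_of_two_classes {m : ℕ} (hm : m ≤ n) (f : ZMod (p ^ n) → ℂ) (B : ℝ)
    (hB : ∀ b, ‖f b‖ ≤ B) (a : ZMod (p ^ n))
    (h : ∀ b, f b ≠ 0 → (p : ZMod (p ^ n)) ^ m ∣ b - a ∨ (p : ZMod (p ^ n)) ^ m ∣ b + a) :
    ‖∑ b, f b‖ ≤ 2 * (p : ℝ) ^ (n - m) * B := by
  classical
  set S := (Finset.univ.filter fun b : ZMod (p ^ n) => (p : ZMod (p ^ n)) ^ m ∣ b - a) ∪
    (Finset.univ.filter fun b : ZMod (p ^ n) => (p : ZMod (p ^ n)) ^ m ∣ b - -a) with hS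
  have h1 : ∑ b, f b = ∑ b ∈ S, f b := by
    refine (Finset.sum_subset (Finset.subset_univ S) fun b _ hb => ?_).symm
    by_contra hf
    refine hb ?_
    rw [hS, Finset.mem_union, Finset.mem_filter, Finset.mem_filter, sub_neg_eq_add]
    simpa using h b hf
  have h2 : (S.card : ℝ) ≤ 2 * (p : ℝ) ^ (n - m) := by
    have := Finset.card_union_le
      (Finset.univ.filter fun b : ZMod (p ^ n) => (p : ZMod (p ^ n)) ^ m ∣ b - a)
      (Finset.univ.filter fun b : ZMod (p ^ n) => (p : ZMod (p ^ n)) ^ m ∣ b - -a)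
    rw [card_pow_dvd_sub hm, card_pow_dvd_sub hm, ← two_mul] at this
    rw [hS]
    calc _ ≤ ((2 * p ^ (n - m) : ℕ) : ℝ) := Nat.cast_le.2 this
      _ = _ := by push_cast; rfl
  rw [h1]
  refine (norm_sum_le_of_le S fun b _ => hB b).trans ?_
  rw [Finset.sum_const, nsmul_eq_mul]
  exact mul_le_mul_of_nonneg_right h2 ((norm_nonneg _).trans (hB 0))

end squares

section values

variable {p k : ℕ} [Fact p.Prime]

/-- The sum of `F(·, y)` over the class `b + p^j R`, each element counted `p^j` times. -/
def classSum (F : ZMod (p ^ (2 * k)) → ZMod (p ^ (2 * k)) → ℂ) (j : ℕ)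
    (b y : ZMod (p ^ (2 * k))) : ℂ := ∑ τ, F (b + (p : ZMod (p ^ (2 * k))) ^ j * τ) y

theorem classSum_congr {F : ZMod (p ^ (2 * k)) → ZMod (p ^ (2 * k)) → ℂ} {j : ℕ}
    {a b y : ZMod (p ^ (2 * k))} (h : (p : ZMod (p ^ (2 * k))) ^ j ∣ a - b) :
    classSum F j a y = classSum F j b y := by
  obtain ⟨w, hw⟩ := h
  unfold classSum
  rw [← Equiv.sum_comp (Equiv.addRight (-w))]
  refine Finset.sum_congr rfl fun τ _ => ?_
  rw [Equiv.coe_addRight]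
  congr 1
  linear_combination hw

variable {j : ℕ} {D C s : ZMod (p ^ (2 * k))} {κ : ℝ}
  {F : ZMod (p ^ (2 * k)) → ZMod (p ^ (2 * k)) → ℂ}

theorem HeckeCoeff.exists_onConic (h : HeckeCoeff j D C s κ F) {b y : ZMod (p ^ (2 * k))}
    (hb : classSum F j b y ≠ 0) :
    ∃ a, (p : ZMod (p ^ (2 * k))) ^ j ∣ a - b ∧ OnConic D C a y := by
  obtain ⟨τ, _, hτ⟩ := Finset.exists_ne_zero_of_sum_ne_zero hb
  refine ⟨b + (p : ZMod (p ^ (2 * k))) ^ j * τ, ⟨τ, by ring⟩, ?_⟩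
  by_contra hc
  exact hτ (h.eq_zero _ _ hc)

theorem HeckeCoeff.pow_dvd_linear (hp : 3 < p) (hk : 1 < k) (hj1 : 3 * j ≤ 2 * k)
    (hj2 : 2 * k ≤ 3 * j + 2) (h : HeckeCoeff j D C s κ F)
    {a y : ZMod (p ^ (2 * k))} (hD : IsUnit D) (hy : IsUnit y) (ha : OnConic D C a y)
    (hne : classSum F j a y ≠ 0) {l : ℕ} (hl : l ≤ j) (hla : (p : ZMod (p ^ (2 * k))) ^ l ∣ a) :
    (p : ZMod (p ^ (2 * k))) ^ (2 * j + l) ∣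
      (p : ZMod (p ^ (2 * k))) ^ j * (-s + r p k * D * y ^ 2 - r p k * a ^ 2) := by
  rw [classSum, h.sum_class hp (by omega) (by omega) (by omega) (by omega) hD hy ha] at hne
  refine pow_dvd_of_cubicSum_ne_zero (by omega) ?_ ?_ (right_ne_zero_of_mul hne)
  · rw [dvd_neg, pow_add]
    exact mul_dvd_mul_left _ ((hla.mul_left _).mul_right _)
  · rw [dvd_neg]
    exact (pow_dvd_pow _ (by omega)).mul_right _

theorem HeckeCoeff.norm_classSum_le (hp : 3 < p) (hk : 1 < k) (hj1 : 3 * j ≤ 2 * k)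
    (hj2 : 2 * k ≤ 3 * j + 2) (h : HeckeCoeff j D C s κ F)
    {a y : ZMod (p ^ (2 * k))} (hD : IsUnit D) (hy : IsUnit y) (ha : OnConic D C a y)
    (hja : ¬ (p : ZMod (p ^ (2 * k))) ^ j ∣ a) :
    ‖classSum F j a y‖ ≤ κ * √((p : ℝ) ^ (2 * k + 3 * j - 1)) := by
  have hp2 : p ≠ 2 := by omega
  obtain ⟨l, hl, u, hu, rfl⟩ := (pow_dvd_or_exists_isUnit j a).resolve_left hja
  rw [classSum, h.sum_class hp (by omega) (by omega) (by omega) (by omega) hD hy ha, norm_mul,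
    h.norm_eq _ _ ha]
  refine mul_le_mul_of_nonneg_left (Real.le_sqrt_of_sq_le ?_)
    (by rw [← h.norm_eq _ _ ha]; exact norm_nonneg _)
  have hr : IsUnit (r p k) := IsUnit.of_mul_eq_one (2 : ZMod (p ^ (2 * k)))
    (by linear_combination two_r p k hp2)
  have h1 : -((p : ZMod (p ^ (2 * k))) ^ (2 * j) *
      (r p k * D * ((p : ZMod (p ^ (2 * k))) ^ l * u) * y)) =
      (p : ZMod (p ^ (2 * k))) ^ (2 * j + l) * (-(r p k * D * u * y)) := by ring
  have h3 : ∀ z : ZMod (p ^ (2 * k)), -((p : ZMod (p ^ (2 * k))) ^ (3 * j) * z) =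
      (p : ZMod (p ^ (2 * k))) ^ (2 * j + l + 1) *
        (-((p : ZMod (p ^ (2 * k))) ^ (j - l - 1) * z)) := by
    intro z
    rw [show 3 * j = (2 * j + l + 1) + (j - l - 1) by omega, pow_add]
    ring
  rw [h1, h3]
  refine (norm_cubicSum_sq_le hp2 (by omega) _ (((hr.mul hD).mul hu).mul hy).neg).trans ?_
  rw [← pow_add]
  exact pow_le_pow_right₀ (by exact_mod_cast (Fact.out : p.Prime).one_lt.le) (by omega)

theorem HeckeCoeff.two_classes (hp : 3 < p) (hk : 1 < k) (hj1 : 3 * j ≤ 2 * k)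
    (hj2 : 2 * k ≤ 3 * j + 2) (h : HeckeCoeff j D C s κ F)
    {b b' y : ZMod (p ^ (2 * k))} (hD : IsUnit D) (hy : IsUnit y)
    (hb : classSum F j b y ≠ 0) (hb' : classSum F j b' y ≠ 0)
    (hjb : ¬ (p : ZMod (p ^ (2 * k))) ^ j ∣ b) :
    (p : ZMod (p ^ (2 * k))) ^ j ∣ b' - b ∨ (p : ZMod (p ^ (2 * k))) ^ j ∣ b' + b := by
  have hp2 : p ≠ 2 := by omega
  obtain ⟨a, hab, ha⟩ := h.exists_onConic hb
  obtain ⟨a', hab', ha'⟩ := h.exists_onConic hb'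
  have h1 := pow_dvd_sub_or_add_of_pow_dvd_sq_sub hp2 (n := 2 * k) (j := j) hj1 (a := a) (b := a')
    (fun hd => hjb ((dvd_sub_right hd).1 hab)) (fun l hl hla hla' => by
      have h2 := h.pow_dvd_linear hp hk hj1 hj2 hD hy ha (by rwa [classSum_congr hab]) hl hla
      have h3 := h.pow_dvd_linear hp hk hj1 hj2 hD hy ha' (by rwa [classSum_congr hab']) hl hla'
      have h4 := (h2.sub h3).mul_left 2
      convert h4 using 1
      linear_combination -((p : ZMod (p ^ (2 * k))) ^ j * (a' ^ 2 - a ^ 2)) * two_r p k hp2)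
  rcases h1 with h1 | h1
  · left
    have := (h1.sub hab').add hab
    convert this using 1
    ring
  · right
    have := (h1.sub hab').sub hab
    convert this using 1
    ring

end values

/-! ### The sup norm as a supremum of cubic sums -/

section sup

variable {p n : ℕ} [Fact p.Prime]

/-- The supremum over `v` of the sums `∑ e(p^m (v t + γ t³))`. -/
def cubicSup (m : ℕ) (γ : ZMod (p ^ n)) : ℝ :=
  ⨆ v : ZMod (p ^ n), ‖cubicSum ((p : ZMod (p ^ n)) ^ m * v) 0 ((p : ZMod (p ^ n)) ^ m * γ)‖

theorem norm_le_cubicSup (m : ℕ) (γ v : ZMod (p ^ n)) :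
    ‖cubicSum ((p : ZMod (p ^ n)) ^ m * v) 0 ((p : ZMod (p ^ n)) ^ m * γ)‖ ≤ cubicSup m γ :=
  le_ciSup (f := fun v => ‖cubicSum ((p : ZMod (p ^ n)) ^ m * v) 0
    ((p : ZMod (p ^ n)) ^ m * γ)‖) (Set.finite_range _).bddAbove v

/-- The supremum is at least the root mean square. -/
theorem sqrt_le_cubicSup {m : ℕ} (hm : m ≤ n) (γ : ZMod (p ^ n)) :
    √((p : ℝ) ^ (n + m)) ≤ cubicSup m γ := by
  have hp0 : (0 : ℝ) < p := by exact_mod_cast (Fact.out : p.Prime).pos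
  have h1 := sum_norm_sq_sum_mul_e (fun t => e ((p : ZMod (p ^ n)) ^ m * γ * t ^ 3))
    (fun t => (p : ZMod (p ^ n)) ^ m * t) (p ^ m)
    (fun s t h => by
      congr 1
      linear_combination γ * (s ^ 2 + s * t + t ^ 2) * h)
    (fun t => by
      rw [← card_pow_mul_eq_zero (p := p) (n := n) (a := m) (b := n - m) (by omega)]
      refine Finset.card_equiv (Equiv.subRight t) fun s => ?_
      rw [Finset.mem_filter, Finset.mem_filter, Equiv.subRight_apply, mul_sub, sub_eq_zero]
      simp)
  have h2 : ∀ v : ZMod (p ^ n), ∑ t, e ((p : ZMod (p ^ n)) ^ m * γ * t ^ 3) *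
      e (v * ((p : ZMod (p ^ n)) ^ m * t)) =
      cubicSum ((p : ZMod (p ^ n)) ^ m * v) 0 ((p : ZMod (p ^ n)) ^ m * γ) := by
    intro v
    refine Finset.sum_congr rfl fun t _ => ?_
    rw [← e_add]; congr 1; ring
  simp_rw [h2, norm_e] at h1
  have hM : 0 ≤ cubicSup m γ := (norm_nonneg _).trans (norm_le_cubicSup m γ 0)
  have h3 : ∑ v : ZMod (p ^ n), ‖cubicSum ((p : ZMod (p ^ n)) ^ m * v) 0
      ((p : ZMod (p ^ n)) ^ m * γ)‖ ^ 2 ≤ ∑ _v : ZMod (p ^ n), cubicSup m γ ^ 2 :=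
    Finset.sum_le_sum fun v _ => pow_le_pow_left₀ (norm_nonneg _) (norm_le_cubicSup m γ v) 2
  rw [h1] at h3
  simp only [one_pow, Finset.sum_const, Finset.card_univ, ZMod.card, nsmul_eq_mul, mul_one,
    Nat.cast_pow] at h3
  refine (Real.sqrt_le_iff).2 ⟨hM, ?_⟩
  rw [pow_add]
  refine le_of_mul_le_mul_left (a := (p : ℝ) ^ n) ?_ (by positivity)
  linarith

end sup

section supNorm

variable {p k : ℕ} [Fact p.Prime] {j : ℕ} {D C s : ZMod (p ^ (2 * k))} {κ : ℝ}
  {F : ZMod (p ^ (2 * k)) → ZMod (p ^ (2 * k)) → ℂ} {ψ : State p k}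

theorem sum_classSum (hψ : ∀ y, ∑ a, F a y = (p : ℂ) ^ (3 * k) * ψ y) (y : ZMod (p ^ (2 * k))) :
    ∑ b, classSum F j b y = (p : ℂ) ^ (5 * k) * ψ y := by
  have := sum_sum_add_mul ((p : ZMod (p ^ (2 * k))) ^ j) fun a => F a y
  unfold classSum
  rw [this, hψ]
  push_cast
  ring

/-- If only the class of `0` contributes to the value at `y`, it determines the value. -/
theorem norm_value_eq_of_classSum (hjk : j ≤ 2 * k)
    (hψ : ∀ y, ∑ a, F a y = (p : ℂ) ^ (3 * k) * ψ y) {y : ZMod (p ^ (2 * k))}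
    (h : ∀ b, classSum F j b y ≠ 0 → (p : ZMod (p ^ (2 * k))) ^ j ∣ b) :
    ‖ψ y‖ = ‖classSum F j 0 y‖ / (p : ℝ) ^ (3 * k + j) := by
  classical
  have hp0 : (0 : ℝ) < p := by exact_mod_cast (Fact.out : p.Prime).pos
  have h1 : ∑ b, classSum F j b y = (p : ℂ) ^ (2 * k - j) * classSum F j 0 y := by
    have h2 : ∀ b, classSum F j b y =
        if (p : ZMod (p ^ (2 * k))) ^ j ∣ b - 0 then classSum F j 0 y else 0 := by
      intro b
      split_ifs with hb
      · exact classSum_congr hb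
      · by_contra hne
        exact hb (by rw [sub_zero]; exact h b hne)
    rw [Finset.sum_congr rfl fun b _ => h2 b, ← Finset.sum_filter, Finset.sum_const,
      card_pow_dvd_sub hjk, nsmul_eq_mul]
    push_cast; rfl
  rw [sum_classSum hψ] at h1
  have h3 := congrArg norm h1
  rw [norm_mul, norm_mul, norm_pow, norm_pow, Complex.norm_natCast,
    show 5 * k = (2 * k - j) + (3 * k + j) by omega, pow_add, mul_assoc] at h3
  rw [eq_div_iff (by positivity), mul_comm]
  exact mul_left_cancel₀ (by positivity) h3

theorem isUnit_of_dvd_sub (hC : IsUnit C) {y : ZMod (p ^ (2 * k))}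
    (hy : (p : ZMod (p ^ (2 * k))) ∣ D * y ^ 2 - C) : IsUnit y := by
  have h1 := isUnit_add_of_dvd hC hy
  rw [add_sub_cancel] at h1
  exact (isUnit_pow_iff two_ne_zero).1 (isUnit_of_mul_isUnit_right h1)

theorem onConic_zero (hj : k ≤ 2 * j) {a y : ZMod (p ^ (2 * k))} (h : OnConic D C a y)
    (ha : (p : ZMod (p ^ (2 * k))) ^ j ∣ a) : OnConic D C 0 y := by
  obtain ⟨w, rfl⟩ := ha
  have h1 : (p : ZMod (p ^ (2 * k))) ^ k * ((p : ZMod (p ^ (2 * k))) ^ j) ^ 2 = 0 := by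
    rw [← pow_mul, ← pow_add]; exact pow_eq_zero_of_le_exp (by omega)
  unfold OnConic at h ⊢
  linear_combination h - w ^ 2 * h1

/-- The contribution of the class of `0`. -/
theorem HeckeCoeff.classSum_zero (hp : 3 < p) (hk : 1 < k) (hj1 : 3 * j ≤ 2 * k)
    (hj2 : 2 * k ≤ 3 * j + 2) (h : HeckeCoeff j D C s κ F) (hD : IsUnit D)
    {y : ZMod (p ^ (2 * k))} (hy : IsUnit y) (h0 : OnConic D C 0 y) (v : ZMod (p ^ (2 * k)))
    (hv : (p : ZMod (p ^ (2 * k))) ^ j * (-s + r p k * D * y ^ 2) =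
      (p : ZMod (p ^ (2 * k))) ^ (3 * j) * v) :
    ‖classSum F j 0 y‖ = κ * ‖cubicSum ((p : ZMod (p ^ (2 * k))) ^ (3 * j) * v) 0
      ((p : ZMod (p ^ (2 * k))) ^ (3 * j) * -(sixth p k * D * C))‖ := by
  rw [classSum, h.sum_class hp (by omega) (by omega) (by omega) (by omega) hD hy h0, norm_mul,
    h.norm_eq _ _ h0]
  have h1 : (p : ZMod (p ^ (2 * k))) ^ (3 * j) =
      (p : ZMod (p ^ (2 * k))) ^ (3 * j - k) * (p : ZMod (p ^ (2 * k))) ^ k := by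
    rw [← pow_add]; congr 1; omega
  unfold OnConic at h0
  congr 3
  · linear_combination hv
  · ring
  · rw [h1]
    linear_combination (p : ZMod (p ^ (2 * k))) ^ (3 * j - k) * sixth p k * D * h0

/-- Every value of the cubic sum is attained, up to normalization. -/
theorem HeckeCoeff.exists_value (hp : 3 < p) (hk : 1 < k) (hj1 : 3 * j ≤ 2 * k)
    (hj2 : 2 * k ≤ 3 * j + 2) (h : HeckeCoeff j D C s κ F) (hD : IsUnit D) (hC : IsUnit C)
    (hψ : ∀ y, ∑ a, F a y = (p : ℂ) ^ (3 * k) * ψ y)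
    {y₀ : ZMod (p ^ (2 * k))} (hy₀ : (p : ZMod (p ^ (2 * k))) ∣ D * y₀ ^ 2 - C)
    (v : ZMod (p ^ (2 * k))) :
    ∃ y, ‖ψ y‖ = κ * ‖cubicSum ((p : ZMod (p ^ (2 * k))) ^ (3 * j) * v) 0
      ((p : ZMod (p ^ (2 * k))) ^ (3 * j) * -(sixth p k * D * C))‖ / (p : ℝ) ^ (3 * k + j) := by
  have hp2 : p ≠ 2 := by omega
  have h2 := two_r p k hp2
  have hPj : (p : ZMod (p ^ (2 * k))) ^ k * (p : ZMod (p ^ (2 * k))) ^ (2 * j) = 0 := by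
    rw [← pow_add]; exact pow_eq_zero_of_le_exp (by omega)
  have hw := h.weight
  -- solve `D y² = 2 s + 2 p^(2 j) v`
  obtain ⟨y, hy⟩ : ∃ y, D * y ^ 2 = 2 * s + 2 * (p : ZMod (p ^ (2 * k))) ^ (2 * j) * v := by
    have hpk : (p : ZMod (p ^ (2 * k))) ∣ 2 * s - C := by
      rw [pow_mul_eq_zero_iff_dvd (b := k) (by omega)] at hw
      exact (dvd_pow_self _ (by omega)).trans hw
    have hpj : (p : ZMod (p ^ (2 * k))) ∣ 2 * (p : ZMod (p ^ (2 * k))) ^ (2 * j) * v :=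
      ((dvd_pow_self _ (by omega)).mul_left _).mul_right _
    obtain ⟨m, hm⟩ := (hpk.add hpj).sub hy₀
    have hu := hD.mul ((isUnit_of_dvd_sub hC hy₀).pow 2)
    obtain ⟨w, hwu⟩ := hu.exists_right_inv
    obtain ⟨ν, hν⟩ := exists_sq_eq_one_add_mul hp2 (w * m)
    refine ⟨y₀ * (1 + p * ν), ?_⟩
    linear_combination D * y₀ ^ 2 * hν + p * m * hwu - hm
  have hP0 : OnConic D C 0 y := by
    unfold OnConic
    linear_combination -((p : ZMod (p ^ (2 * k))) ^ k) * hy - hw - 2 * v * hPj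
  have hpy : (p : ZMod (p ^ (2 * k))) ∣ D * y ^ 2 - C := by
    have h3 : (p : ZMod (p ^ (2 * k))) ^ k * (D * y ^ 2 - C) = 0 := by
      unfold OnConic at hP0
      linear_combination -hP0
    rw [pow_mul_eq_zero_iff_dvd (b := k) (by omega)] at h3
    exact (dvd_pow_self _ (by omega)).trans h3
  have hyu := isUnit_of_dvd_sub hC hpy
  have hlin : (p : ZMod (p ^ (2 * k))) ^ j * (-s + r p k * D * y ^ 2) =
      (p : ZMod (p ^ (2 * k))) ^ (3 * j) * v := by
    rw [show 3 * j = j + 2 * j by ring, pow_add]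
    linear_combination (p : ZMod (p ^ (2 * k))) ^ j * r p k * hy +
      (p : ZMod (p ^ (2 * k))) ^ j * (s + (p : ZMod (p ^ (2 * k))) ^ (2 * j) * v) * h2
  refine ⟨y, ?_⟩
  rw [norm_value_eq_of_classSum (j := j) (by omega) hψ,
    h.classSum_zero hp hk hj1 hj2 hD hyu hP0 v hlin]
  intro b hb
  obtain ⟨a, hab, ha⟩ := h.exists_onConic hb
  by_contra hjb
  have hja : ¬ (p : ZMod (p ^ (2 * k))) ^ j ∣ a := fun hd => hjb ((dvd_sub_right hd).1 hab)
  have h4 : ∀ l ≤ j, (p : ZMod (p ^ (2 * k))) ^ l ∣ a →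
      (p : ZMod (p ^ (2 * k))) ^ (2 * j + l) ∣
        (p : ZMod (p ^ (2 * k))) ^ j * (r p k * a ^ 2) := by
    intro l hl hla
    have h5 := h.pow_dvd_linear hp hk hj1 hj2 hD hyu ha (by rwa [classSum_congr hab]) hl hla
    have h6 : (p : ZMod (p ^ (2 * k))) ^ (2 * j + l) ∣
        (p : ZMod (p ^ (2 * k))) ^ (3 * j) * v := (pow_dvd_pow _ (by omega)).mul_right _
    have h7 := h6.sub h5
    rw [← hlin] at h7
    convert h7 using 1
    ring
  obtain ⟨l, hl, u, hu, rfl⟩ := (pow_dvd_or_exists_isUnit j a).resolve_left hja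
  have hr : IsUnit (r p k) := IsUnit.of_mul_eq_one (2 : ZMod (p ^ (2 * k)))
    (by linear_combination h2)
  refine not_pow_dvd_pow_mul_of_isUnit (a := j + 2 * l) (b := 2 * j + l) (by omega) (by omega)
    (hr.mul (hu.pow 2)) ?_
  convert h4 l hl.le (Dvd.intro _ rfl) using 1
  ring

/-- The value at every point is bounded by the supremum of the cubic sums. -/
theorem HeckeCoeff.norm_value_le (hp : 3 < p) (hk : 1 < k) (hj1 : 3 * j ≤ 2 * k)
    (hj2 : 2 * k ≤ 3 * j + 2) (h : HeckeCoeff j D C s κ F) (hD : IsUnit D) (hC : IsUnit C)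
    (hκ : 0 ≤ κ) (hψ : ∀ y, ∑ a, F a y = (p : ℂ) ^ (3 * k) * ψ y) (y : ZMod (p ^ (2 * k))) :
    ‖ψ y‖ ≤ κ * cubicSup (3 * j) (-(sixth p k * D * C)) / (p : ℝ) ^ (3 * k + j) := by
  have hp2 : p ≠ 2 := by omega
  have hp4 : (4 : ℝ) ≤ p := by exact_mod_cast hp
  have hp0 : (0 : ℝ) < p := by linarith
  have hsup := sqrt_le_cubicSup (p := p) (n := 2 * k) hj1 (-(sixth p k * D * C))
  rcases isUnit_or_dvd (D * y ^ 2 - C) with hu | hd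
  · -- at most two coefficients contribute
    have hconic : ∀ a, F a y ≠ 0 → (p : ZMod (p ^ (2 * k))) ^ k ∣ a ^ 2 - (D * y ^ 2 - C) := by
      intro a ha
      have h1 : OnConic D C a y := by
        by_contra hc
        exact ha (h.eq_zero _ _ hc)
      rw [OnConic, pow_mul_eq_zero_iff_dvd (b := k) (by omega)] at h1
      convert h1 using 1
      ring
    have hbound : ∀ a, ‖F a y‖ ≤ κ := by
      intro a
      by_cases hc : OnConic D C a y
      · exact (h.norm_eq _ _ hc).le
      · rw [h.eq_zero _ _ hc, norm_zero]; exact hκ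
    have h2 : ‖∑ a, F a y‖ ≤ 2 * (p : ℝ) ^ (2 * k - k) * κ := by
      by_cases hex : ∃ a₀, F a₀ y ≠ 0
      · obtain ⟨a₀, ha₀⟩ := hex
        have h3 := hconic a₀ ha₀
        have ha₀u : IsUnit a₀ := by
          have := isUnit_add_of_dvd hu ((dvd_pow_self _ (by omega : k ≠ 0)).trans h3)
          rw [add_sub_cancel] at this
          exact (isUnit_pow_iff two_ne_zero).1 this
        refine norm_sum_le_of_two_classes (m := k) (by omega) _ κ hbound a₀ fun a ha => ?_
        refine pow_dvd_sub_or_pow_dvd_add hp2 ha₀u ?_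
        convert (hconic a ha).sub h3 using 1
        ring
      · push Not at hex
        rw [Finset.sum_eq_zero fun a _ => hex a, norm_zero]
        positivity
    rw [hψ, norm_mul, norm_pow, Complex.norm_natCast, show 2 * k - k = k by omega] at h2
    have h4 : 2 * (p : ℝ) ^ (k + j) ≤ √((p : ℝ) ^ (2 * k + 3 * j)) := by
      refine Real.le_sqrt_of_sq_le ?_
      have h5 : (p : ℝ) ^ (2 * k + 3 * j) = p ^ j * ((p : ℝ) ^ (k + j)) ^ 2 := by
        rw [← pow_mul, ← pow_add]; congr 1; ring
      have h6 : (p : ℝ) ^ 1 ≤ p ^ j := pow_le_pow_right₀ (by linarith) (by omega)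
      rw [h5, mul_pow]
      refine mul_le_mul_of_nonneg_right ?_ (by positivity)
      linarith
    rw [le_div_iff₀ (by positivity)]
    calc ‖ψ y‖ * (p : ℝ) ^ (3 * k + j) = (p : ℝ) ^ (3 * k) * ‖ψ y‖ * p ^ j := by
          rw [pow_add]; ring
      _ ≤ 2 * (p : ℝ) ^ k * κ * p ^ j := mul_le_mul_of_nonneg_right h2 (by positivity)
      _ = κ * (2 * (p : ℝ) ^ (k + j)) := by rw [pow_add]; ring
      _ ≤ _ := mul_le_mul_of_nonneg_left (h4.trans hsup) hκ
  · have hyu := isUnit_of_dvd_sub hC hd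
    by_cases hex : ∃ b, classSum F j b y ≠ 0 ∧ ¬ (p : ZMod (p ^ (2 * k))) ^ j ∣ b
    · -- two classes with square root cancellation
      obtain ⟨b, hb, hjb⟩ := hex
      have hbound : ∀ b', ‖classSum F j b' y‖ ≤ κ * √((p : ℝ) ^ (2 * k + 3 * j - 1)) := by
        intro b'
        by_cases hb' : classSum F j b' y = 0
        · rw [hb', norm_zero]; positivity
        · obtain ⟨a, hab, ha⟩ := h.exists_onConic hb'
          rw [← classSum_congr hab]
          refine h.norm_classSum_le hp hk hj1 hj2 hD hyu ha fun hja => hjb ?_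
          have hb'd : (p : ZMod (p ^ (2 * k))) ^ j ∣ b' := (dvd_sub_right hja).1 hab
          rcases h.two_classes hp hk hj1 hj2 hD hyu hb hb' hjb with h1 | h1
          · exact (dvd_sub_right hb'd).1 h1
          · exact (dvd_add_right hb'd).1 h1
      have h2 := norm_sum_le_of_two_classes (m := j) (by omega) (fun b' => classSum F j b' y) _
        hbound b fun b' hb' => h.two_classes hp hk hj1 hj2 hD hyu hb hb' hjb
      rw [sum_classSum hψ, norm_mul, norm_pow, Complex.norm_natCast] at h2
      have h4 : 2 * √((p : ℝ) ^ (2 * k + 3 * j - 1)) ≤ √((p : ℝ) ^ (2 * k + 3 * j)) := by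
        refine Real.le_sqrt_of_sq_le ?_
        rw [mul_pow, Real.sq_sqrt (by positivity)]
        have h5 : (p : ℝ) ^ (2 * k + 3 * j) = p * (p : ℝ) ^ (2 * k + 3 * j - 1) := by
          rw [← pow_succ']; congr 1; omega
        rw [h5]
        refine mul_le_mul_of_nonneg_right ?_ (by positivity)
        linarith
      rw [le_div_iff₀ (by positivity)]
      refine le_of_mul_le_mul_left (a := (p : ℝ) ^ (2 * k - j)) ?_ (by positivity)
      calc (p : ℝ) ^ (2 * k - j) * (‖ψ y‖ * (p : ℝ) ^ (3 * k + j))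
          = (p : ℝ) ^ (5 * k) * ‖ψ y‖ := by
            rw [mul_left_comm, ← pow_add, mul_comm]; congr 2; omega
        _ ≤ 2 * (p : ℝ) ^ (2 * k - j) * (κ * √((p : ℝ) ^ (2 * k + 3 * j - 1))) := h2
        _ = (p : ℝ) ^ (2 * k - j) * (κ * (2 * √((p : ℝ) ^ (2 * k + 3 * j - 1)))) := by ring
        _ ≤ _ := mul_le_mul_of_nonneg_left
          (mul_le_mul_of_nonneg_left (h4.trans hsup) hκ) (by positivity)
    · push Not at hex
      rw [norm_value_eq_of_classSum (j := j) (by omega) hψ hex]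
      refine div_le_div_of_nonneg_right ?_ (by positivity)
      by_cases h0 : classSum F j 0 y = 0
      · rw [h0, norm_zero]
        exact mul_nonneg hκ ((Real.sqrt_nonneg _).trans hsup)
      · obtain ⟨a, hab, ha⟩ := h.exists_onConic h0
        rw [sub_zero] at hab
        have hP0 := onConic_zero (by omega) ha hab
        obtain ⟨v, hv⟩ := h.pow_dvd_linear hp hk hj1 hj2 hD hyu hP0 h0 le_rfl (dvd_zero _)
        rw [h.classSum_zero hp hk hj1 hj2 hD hyu hP0 v (by
          rw [show 3 * j = 2 * j + j by ring, ← hv]; ring)]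
        exact mul_le_mul_of_nonneg_left (norm_le_cubicSup _ _ _) hκ

theorem HeckeCoeff.supNorm_eq (hp : 3 < p) (hk : 1 < k) (hj1 : 3 * j ≤ 2 * k)
    (hj2 : 2 * k ≤ 3 * j + 2) (h : HeckeCoeff j D C s κ F) (hD : IsUnit D) (hC : IsUnit C)
    (hκ : 0 ≤ κ) (hψ : ∀ y, ∑ a, F a y = (p : ℂ) ^ (3 * k) * ψ y)
    {y₀ : ZMod (p ^ (2 * k))} (hy₀ : (p : ZMod (p ^ (2 * k))) ∣ D * y₀ ^ 2 - C) :
    supNorm p k ψ =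
      κ * cubicSup (3 * j) (-(sixth p k * D * C)) / (p : ℝ) ^ (3 * k + j) := by
  refine le_antisymm (ciSup_le fun y => h.norm_value_le hp hk hj1 hj2 hD hC hκ hψ y) ?_
  obtain ⟨v, hv⟩ := exists_eq_ciSup_of_finite (f := fun v : ZMod (p ^ (2 * k)) =>
    ‖cubicSum ((p : ZMod (p ^ (2 * k))) ^ (3 * j) * v) 0
      ((p : ZMod (p ^ (2 * k))) ^ (3 * j) * -(sixth p k * D * C))‖)
  obtain ⟨y, hy⟩ := h.exists_value hp hk hj1 hj2 hD hC hψ hy₀ v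
  rw [cubicSup, ← hv, ← hy]
  exact le_ciSup (f := fun y => ‖ψ y‖) (Set.finite_range _).bddAbove y

end supNorm

/-! ### The constants `A_{α,n}` and the values of the sup norm -/

section const

variable {p : ℕ} [Fact p.Prime]

theorem e_pow_mul {m l n : ℕ} (h : m + l = n) (z : ZMod (p ^ n)) :
    e ((p : ZMod (p ^ n)) ^ m * z) = e (z.cast : ZMod (p ^ l)) := by
  obtain ⟨i, rfl⟩ := ZMod.intCast_surjective z
  have hp : (p : ℂ) ≠ 0 := by exact_mod_cast (Fact.out : p.Prime).ne_zero
  have h1 : (p : ZMod (p ^ n)) ^ m * (i : ZMod (p ^ n)) =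
      (((p : ℤ) ^ m * i : ℤ) : ZMod (p ^ n)) := by push_cast; ring
  rw [h1, ZMod.cast_intCast (pow_dvd_pow p (by omega : l ≤ n))]
  unfold e
  rw [ZMod.stdAddChar_coe, ZMod.stdAddChar_coe]
  congr 1
  subst h
  push_cast
  rw [pow_add]
  field_simp

theorem cubicSum_eq_expSum {m l n : ℕ} (h : m + l = n) (v γ : ZMod (p ^ n)) :
    cubicSum ((p : ZMod (p ^ n)) ^ m * v) 0 ((p : ZMod (p ^ n)) ^ m * γ) =
      (p : ℂ) ^ m * expSum p l (Polynomial.C γ.cast * Polynomial.X ^ 3 +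
        Polynomial.C v.cast * Polynomial.X) := by
  have hd : p ^ l ∣ p ^ n := pow_dvd_pow p (by omega)
  have h1 := sum_comp_cast (m := p ^ l) (M := p ^ n) (c := p ^ m)
    (by rw [← pow_add, add_comm, h]) (fun z => e (Polynomial.eval z
      (Polynomial.C (γ.cast : ZMod (p ^ l)) * Polynomial.X ^ 3 +
        Polynomial.C (v.cast : ZMod (p ^ l)) * Polynomial.X)))
  push_cast at h1
  rw [expSum, ← h1, cubicSum]
  refine Finset.sum_congr rfl fun t _ => ?_
  rw [show (p : ZMod (p ^ n)) ^ m * v * t + 0 * t ^ 2 + (p : ZMod (p ^ n)) ^ m * γ * t ^ 3 =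
    (p : ZMod (p ^ n)) ^ m * (γ * t ^ 3 + v * t) by ring, e_pow_mul h]
  congr 1
  rw [← ZMod.castHom_apply (h := hd) (γ * t ^ 3 + v * t)]
  simp only [map_add, map_mul, map_pow, ZMod.castHom_apply, Polynomial.eval_add,
    Polynomial.eval_mul, Polynomial.eval_C, Polynomial.eval_pow, Polynomial.eval_X]

theorem cubicSup_eq_cubicConst {m l n : ℕ} (h : m + l = n) (γ : ZMod (p ^ n)) :
    cubicSup m γ = (p : ℝ) ^ m * (cubicConst p l γ.cast * (p : ℝ) ^ ((l : ℝ) / 2)) := by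
  have hp0 : (0 : ℝ) < p := by exact_mod_cast (Fact.out : p.Prime).pos
  have hd : p ^ l ∣ p ^ n := pow_dvd_pow p (by omega)
  unfold cubicSup cubicConst
  rw [div_mul_cancel₀ _ (Real.rpow_pos_of_pos hp0 _).ne']
  simp_rw [cubicSum_eq_expSum h, norm_mul, norm_pow, Complex.norm_natCast]
  rw [← Real.mul_iSup_of_nonneg (by positivity)]
  congr 1
  exact (ZMod.castHom_surjective hd).iSup_comp (fun t => ‖expSum p l (Polynomial.C γ.cast *
    Polynomial.X ^ 3 + Polynomial.C t * Polynomial.X)‖)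

theorem cubicConst_mul_cube {n : ℕ} (α : ZMod (p ^ n)) (u : (ZMod (p ^ n))ˣ) :
    cubicConst p n (α * (u : ZMod (p ^ n)) ^ 3) = cubicConst p n α := by
  unfold cubicConst
  congr 1
  rw [← u.mulRight.surjective.iSup_comp]
  refine iSup_congr fun t => ?_
  unfold expSum
  rw [← Equiv.sum_comp u.mulRight (fun z => e (Polynomial.eval z (Polynomial.C α * Polynomial.X ^ 3 +
    Polynomial.C t * Polynomial.X)))]
  congr 1
  refine Finset.sum_congr rfl fun z _ => ?_
  congr 1
  simp only [Polynomial.eval_add, Polynomial.eval_mul, Polynomial.eval_C, Polynomial.eval_pow,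
    Polynomial.eval_X, Units.mulRight_apply]
  ring

theorem cubicConst_zero (α : ZMod (p ^ 0)) : cubicConst p 0 α = 1 := by
  have : Subsingleton (ZMod (p ^ 0)) := by rw [pow_zero]; infer_instance
  have h : ∀ q : Polynomial (ZMod (p ^ 0)), ‖expSum p 0 q‖ = 1 := by
    intro q
    rw [expSum, Fintype.sum_subsingleton _ 0, norm_e]
  unfold cubicConst
  simp_rw [h]
  simp

/-- The unit group is cyclic, so a unit is one of three fixed elements up to a cube. -/
theorem exists_cubicConst_values (hp : p ≠ 2) (n : ℕ) :
    ∃ A B C : ℝ, ∀ α : ZMod (p ^ n), IsUnit α →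
      cubicConst p n α = A ∨ cubicConst p n α = B ∨ cubicConst p n α = C := by
  have := ZMod.isCyclic_units_of_prime_pow p Fact.out hp n
  obtain ⟨g, hg⟩ := IsCyclic.exists_monoid_generator (α := (ZMod (p ^ n))ˣ)
  refine ⟨cubicConst p n ((g ^ 0 : (ZMod (p ^ n))ˣ) : ZMod (p ^ n)),
    cubicConst p n ((g ^ 1 : (ZMod (p ^ n))ˣ) : ZMod (p ^ n)),
    cubicConst p n ((g ^ 2 : (ZMod (p ^ n))ˣ) : ZMod (p ^ n)), ?_⟩
  rintro _ ⟨u, rfl⟩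
  obtain ⟨i, rfl⟩ := Submonoid.mem_powers_iff _ _ |>.1 (hg u)
  have h1 : ((g ^ i : (ZMod (p ^ n))ˣ) : ZMod (p ^ n)) =
      ((g ^ (i % 3) : (ZMod (p ^ n))ˣ) : ZMod (p ^ n)) *
        ((g ^ (i / 3) : (ZMod (p ^ n))ˣ) : ZMod (p ^ n)) ^ 3 := by
    rw [← Units.val_pow_eq_pow_val, ← Units.val_mul, ← pow_mul, ← pow_add]
    congr 2
    omega
  rw [h1, cubicConst_mul_cube]
  have : i % 3 = 0 ∨ i % 3 = 1 ∨ i % 3 = 2 := by omega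
  rcases this with h | h | h <;> rw [h]
  · exact Or.inl rfl
  · exact Or.inr (Or.inl rfl)
  · exact Or.inr (Or.inr rfl)

theorem isUnit_six {n : ℕ} (hp : 3 < p) : IsUnit (6 : ZMod (p ^ n)) := by
  have h : ¬ p ∣ 6 := fun hd => by
    rcases (Nat.Prime.dvd_mul Fact.out).1 (show p ∣ 2 * 3 from hd) with h | h
    · exact absurd (Nat.le_of_dvd (by norm_num) h) (by omega)
    · exact absurd (Nat.le_of_dvd (by norm_num) h) (by omega)
  exact_mod_cast isUnit_natCast_of_not_dvd (n := n) h

theorem isUnit_of_legendreSym_ne_zero {n : ℕ} {x : ZMod (p ^ n)}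
    (h : legendreSym p (x.val : ℤ) ≠ 0) : IsUnit x := by
  rw [← ZMod.natCast_zmod_val x]
  refine isUnit_natCast_of_not_dvd fun hd => h ?_
  rw [legendreSym.eq_zero_iff]
  push_cast
  exact (ZMod.natCast_eq_zero_iff _ _).2 hd

theorem legendreSym_ne_zero_of_isUnit {n : ℕ} (hn : n ≠ 0) {x : ZMod (p ^ n)} (hx : IsUnit x) :
    legendreSym p (x.val : ℤ) ≠ 0 := by
  rw [Ne, legendreSym.eq_zero_iff]
  push_cast
  intro h
  have hd := (ZMod.natCast_eq_zero_iff _ _).1 h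
  refine not_isUnit_of_dvd hn (z := x) ?_ hx
  rw [← ZMod.natCast_zmod_val x]
  exact Nat.cast_dvd_cast hd

theorem exists_eq_mul_sq_of_legendreSym_eq {a b : ℤ} (hb : (b : ZMod p) ≠ 0)
    (ha : (a : ZMod p) ≠ 0) (h : legendreSym p a = legendreSym p b) :
    ∃ y : ZMod p, y ≠ 0 ∧ (a : ZMod p) = b * y ^ 2 := by
  have h1 : legendreSym p (a * b) = 1 := by
    rw [legendreSym.mul, h, ← sq, legendreSym.sq_one p hb]
  have h0 : ((a * b : ℤ) : ZMod p) ≠ 0 := by push_cast; exact mul_ne_zero ha hb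
  obtain ⟨w, hw⟩ := (legendreSym.eq_one_iff p h0).1 h1
  push_cast at hw
  have hw0 : w ≠ 0 := by
    rintro rfl
    rw [mul_zero] at hw
    exact mul_ne_zero ha hb hw
  refine ⟨w / b, div_ne_zero hw0 hb, ?_⟩
  field_simp
  linear_combination hw

end const

/-- The sup norm of a normalized Hecke eigenfunction, uniformly in `k` modulo `3`: `n` is the
residue of `2 k` modulo `3` (so `n ≤ 2`) and `j` the quotient. -/
theorem supNorm_eq_cubicConst {p : ℕ} [Fact p.Prime] (hp : 3 < p) {k : ℕ} (hk : 1 < k) {j n : ℕ}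
    (hjn : 3 * j + n = 2 * k) (hn : n ≤ 2) {D : ZMod (p ^ (2 * k))} {C : ZMod (p ^ k)}
    {ψ : State p k} (hC : IsUnit C)
    (hL : legendreSym p (C.val : ℤ) = legendreSym p (D.val : ℤ)) (hV : ψ ∈ V p k D C)
    (hH : IsHeckeEigenfunction p k D ψ) (hψ : l2Norm p k ψ = 1) :
    supNorm p k ψ = (1 / √(1 - (legendreSym p (D.val : ℤ) : ℝ) * (1 / (p : ℝ)))) *
      (cubicConst p n (36 * C.cast * D.cast) * (p : ℝ) ^ ((j : ℝ) / 2)) := by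
  have hp2 : p ≠ 2 := by omega
  have hp0 : (0 : ℝ) < p := by exact_mod_cast (Fact.out : p.Prime).pos
  have hpd : p ∣ p ^ (2 * k) := dvd_pow_self p (by omega)
  have hnd : p ^ n ∣ p ^ (2 * k) := pow_dvd_pow p (by omega)
  have hC0 := legendreSym_ne_zero_of_isUnit (by omega) hC
  have hD0 : legendreSym p (D.val : ℤ) ≠ 0 := hL ▸ hC0
  have hD := isUnit_of_legendreSym_ne_zero hD0
  -- a lift of `C` to `ℤ_N`
  set C' : ZMod (p ^ (2 * k)) := (C.val : ZMod (p ^ (2 * k))) with hC'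
  have hC'C : C'.cast = C := val_cast p k C
  have hC'u : IsUnit C' := by
    refine isUnit_natCast_of_not_dvd fun hd => hC0 ?_
    rw [legendreSym.eq_zero_iff]
    push_cast
    exact (ZMod.natCast_eq_zero_iff _ _).2 hd
  have hDp : (((D.val : ℤ)) : ZMod p) = D.cast := by
    rw [Int.cast_natCast, ZMod.natCast_val]
  have hCp : (C'.cast : ZMod p) = ((C.val : ℤ) : ZMod p) := by
    rw [hC', ZMod.cast_natCast hpd, Int.cast_natCast]
  have hD1 : (((D.val : ℤ)) : ZMod p) ≠ 0 := fun h => hD0 ((legendreSym.eq_zero_iff p _).2 h)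
  have hC1 : (((C.val : ℤ)) : ZMod p) ≠ 0 := fun h => hC0 ((legendreSym.eq_zero_iff p _).2 h)
  obtain ⟨y₀, hy0, hy⟩ := exists_eq_mul_sq_of_legendreSym_eq hD1 hC1 hL
  have hy₀ : (p : ZMod (p ^ (2 * k))) ∣ D * (y₀.val : ZMod (p ^ (2 * k))) ^ 2 - C' := by
    rw [← cast_eq_zero_iff_natCast_dvd hpd, ← ZMod.castHom_apply (h := hpd)
      (D * (y₀.val : ZMod (p ^ (2 * k))) ^ 2 - C')]
    rw [map_sub, map_mul, map_pow, map_natCast, ZMod.natCast_zmod_val, ZMod.castHom_apply,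
      ZMod.castHom_apply, hCp, ← hDp, hy, sub_self]
  obtain ⟨s, κ, hκ0, h⟩ := exists_heckeCoeff hp (by omega) (j := j) (by omega) (by omega) hC'u
    (hC'C.symm ▸ hV) hH
  have hκ := heckeCoeff_norm hp2 (by omega) hC'u (D.val : ℤ) hDp y₀ hD1 hy0 (by rw [hCp, hy]) h hψ
    hκ0
  have h6u := isUnit_six (n := n) hp
  -- `-1/6` and `36` differ by the cube of `-6`
  have hconst : cubicConst p n ((-(sixth p k * D * C')).cast : ZMod (p ^ n)) =
      cubicConst p n (36 * C.cast * D.cast) := by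
    rw [← cubicConst_mul_cube _ h6u.neg.unit]
    congr 1
    have h1 : -(sixth p k * D * C') * (-6) ^ 3 = 36 * C' * D := by
      linear_combination 36 * D * C' * six_mul_sixth (k := k) hp
    have h2 := congrArg (ZMod.castHom hnd (ZMod (p ^ n))) h1
    rw [map_mul, map_pow, map_neg _ (6 : ZMod (p ^ (2 * k))), map_mul, map_mul, map_ofNat,
      map_ofNat, ZMod.castHom_apply, ZMod.castHom_apply, ZMod.castHom_apply] at h2
    have h3 : (C'.cast : ZMod (p ^ n)) = C.cast := by
      rw [hC', ZMod.cast_natCast hnd, ZMod.natCast_val]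
    rw [← h3, ← h2, IsUnit.unit_spec]
  rw [h.supNorm_eq hp hk (by omega) (by omega) hD hC'u hκ0 (fun y => sum_zetaCoeff p k y ψ) hy₀,
    cubicSup_eq_cubicConst hjn, hconst, hκ]
  have hpow : (p : ℝ) ^ (2 * k) * (p : ℝ) ^ (3 * j) * (p : ℝ) ^ ((n : ℝ) / 2) =
      (p : ℝ) ^ ((j : ℝ) / 2) * (p : ℝ) ^ (3 * k + j) := by
    rw [← Real.rpow_natCast, ← Real.rpow_natCast, ← Real.rpow_natCast, ← Real.rpow_add hp0,
      ← Real.rpow_add hp0, ← Real.rpow_add hp0]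
    congr 1
    have : (3 * j + n : ℝ) = 2 * k := by exact_mod_cast hjn
    push_cast
    linarith
  rw [div_eq_iff (by positivity)]
  linear_combination (1 / √(1 - (legendreSym p (D.val : ℤ) : ℝ) * (1 / (p : ℝ)))) *
    cubicConst p n (36 * C.cast * D.cast) * hpow

end

end CatMap

theorem mainTheorem1 (p : ℕ) [Fact p.Prime] (hp : 3 < p) (k : ℕ) (hk : 1 < k) :
    (∀ (D : ZMod (p ^ (2 * k))) (C : ZMod (p ^ k)) (ψ : CatMap.State p k),
      IsUnit C →
      legendreSym p (C.val : ℤ) = legendreSym p (D.val : ℤ) →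
      ψ ∈ CatMap.V p k D C →
      CatMap.IsHeckeEigenfunction p k D ψ →
      CatMap.l2Norm p k ψ = 1 →
        CatMap.supNorm p k ψ =
          (1 / √(1 - (legendreSym p (D.val : ℤ) : ℝ) * (1 / (p : ℝ)))) *
            (if k % 3 = 0 then
              (p : ℝ) ^ ((k : ℝ) / 3)
            else if k % 3 = 1 then
              CatMap.cubicConst p 2 (36 * C.cast * D.cast) * (p : ℝ) ^ ((k : ℝ) / 3 - 1 / 3)
            else
              CatMap.cubicConst p 1 (36 * C.cast * D.cast) * (p : ℝ) ^ ((k : ℝ) / 3 - 1 / 6))) ∧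
    (∀ ε : ℤ,
      {s : ℝ | ∃ (D : ZMod (p ^ (2 * k))) (C : ZMod (p ^ k)) (ψ : CatMap.State p k),
        IsUnit C ∧
        legendreSym p (C.val : ℤ) = ε ∧ legendreSym p (D.val : ℤ) = ε ∧
        ψ ∈ CatMap.V p k D C ∧
        CatMap.IsHeckeEigenfunction p k D ψ ∧
        CatMap.l2Norm p k ψ = 1 ∧
        s = CatMap.supNorm p k ψ}.encard ≤ 3) := by
  constructor
  · intro D C ψ hC hL hV hH hψ
    split_ifs with h0 h1
    · obtain ⟨m, rfl⟩ : ∃ m, k = 3 * m := ⟨k / 3, by omega⟩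
      rw [CatMap.supNorm_eq_cubicConst hp hk (j := 2 * m) (n := 0) (by ring) (by omega) hC hL hV hH
        hψ, CatMap.cubicConst_zero, one_mul]
      congr 2
      push_cast
      ring
    · obtain ⟨m, rfl⟩ : ∃ m, k = 3 * m + 1 := ⟨k / 3, by omega⟩
      rw [CatMap.supNorm_eq_cubicConst hp hk (j := 2 * m) (n := 2) (by ring) (by omega) hC hL hV hH
        hψ]
      congr 3
      push_cast
      ring
    · obtain ⟨m, rfl⟩ : ∃ m, k = 3 * m + 2 := ⟨k / 3, by omega⟩
      rw [CatMap.supNorm_eq_cubicConst hp hk (j := 2 * m + 1) (n := 1) (by ring) (by omega) hC hL hV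
        hH hψ]
      congr 3
      push_cast
      ring
  · intro ε
    obtain ⟨j, n, hjn, hn⟩ : ∃ j n, 3 * j + n = 2 * k ∧ n ≤ 2 :=
      ⟨2 * k / 3, 2 * k % 3, by omega, by omega⟩
    obtain ⟨A, B, E, hABE⟩ := CatMap.exists_cubicConst_values (p := p) (by omega) n
    let f : ℝ → ℝ := fun x => (1 / √(1 - (ε : ℝ) * (1 / (p : ℝ)))) * (x * (p : ℝ) ^ ((j : ℝ) / 2))
    refine (Set.encard_le_encard (t := {f A, f B, f E}) ?_).trans ?_
    · rintro _ ⟨D, C, ψ, hC, hCε, hDε, hV, hH, hψ, rfl⟩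
      have hα : IsUnit (36 * (C.cast : ZMod (p ^ n)) * (D.cast : ZMod (p ^ n))) := by
        have hCd : p ^ n ∣ p ^ k := pow_dvd_pow p (by omega)
        have hDd : p ^ n ∣ p ^ (2 * k) := pow_dvd_pow p (by omega)
        have hD : IsUnit D := by
          refine CatMap.isUnit_of_legendreSym_ne_zero ?_
          rw [hDε, ← hCε]
          exact CatMap.legendreSym_ne_zero_of_isUnit (by omega) hC
        have h36 := (CatMap.isUnit_six (n := n) hp).pow 2
        norm_num at h36
        exact (h36.mul
          (hC.map (ZMod.castHom hCd (ZMod (p ^ n))))).mul (hD.map (ZMod.castHom hDd (ZMod (p ^ n))))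
      rw [CatMap.supNorm_eq_cubicConst hp hk hjn hn hC (hCε.trans hDε.symm) hV hH hψ, hDε]
      rcases hABE _ hα with h | h | h <;> rw [h]
      · exact Or.inl rfl
      · exact Or.inr (Or.inl rfl)
      · exact Or.inr (Or.inr rfl)
    · refine (Set.encard_insert_le _ _).trans ?_
      refine (add_le_add_left (Set.encard_insert_le _ _) 1).trans ?_
      rw [Set.encard_singleton]
      norm_num
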